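/- Let $N\ge 1$ be an integer and $\hbar,g,\kappa>0$, and put $\rho=\kappa g^{2N}$. Let $\delta_1,\dots,\delta_N\in\mathbb C$ be a family that is invariant under complex conjugation, with $|\mathrm{Im}\,\delta_k|<\hbar/2$, and put $\vartheta(\lambda)=\prod_{k=1}^N(\lambda-\delta_k)$. Let $Y_\delta:\mathbb R\to(0,\infty)$, with $\ln Y_\delta$ continuous, non-negative and bounded, be the solution of the nonlinear integral equation $$\ln Y_\delta(\lambda)=\int_{\mathbb R}\frac{\hbar}{\pi((\lambda-\mu)^2+\hbar^2)}\,\ln V_\delta(\mu)\,d\mu,\qquad V_\delta(\mu)=1+\frac{\rho^\hbar Y_\delta(\mu)}{|\vartheta(\mu-i\hbar/2)|^2}.$$ Let $v_\uparrow(\lambda)=\exp\Big(-\int_{\mathbb R}\frac{d\mu}{2i\pi}\frac{\ln V_\delta(\mu)}{\lambda-\mu+i\hbar/2}\Big)$ for $\mathrm{Im}\,\lambda>-\hbar/2$ and $v_\downarrow(\lambda-i\hbar)=\exp\Big(\int_{\mathbb R}\frac{d\mu}{2i\pi}\frac{\ln V_\delta(\mu)}{\lambda-\mu-i\hbar/2}\Big)$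 for $\mathrm{Im}\,\lambda<\hbar/2$, and let $Q^\pm_\delta$ be the entire functions that continue $$Q_\delta^+(\lambda)=\frac{(\kappa g^N)^{-i\lambda}\,\hbar^{iN\lambda/\hbar}\,e^{-N\pi\lambda/\hbar}\,v_\uparrow(\lambda)}{\prod_{k=1}^N\Gamma(1-i(\lambda-\delta_k)/\hbar)},\qquad Q_\delta^-(\lambda)=\frac{g^{iN\lambda}\,\hbar^{-iN\lambda/\hbar}\,e^{-N\pi\lambda/\hbar}\,v_\downarrow(\lambda-i\hbar)}{\prod_{k=1}^N\Gamma(1+i(\lambda-\delta_k)/\hbar)}$$ from these half-planes. Put $$t_\delta(\lambda)=(-i)^N(\kappa g^N)^\hbar\;\frac{Q_\delta^+(\lambda-i\hbar)Q_\delta^-(\lambda+i\hbar)-Q_\delta^+(\lambda+i\hbar)Q_\delta^-(\lambda-i\hbar)}{Q_\delta^+(\lambda)Q_\delta^-(\lambda+i\hbar)-Q_\delta^+(\lambda+i\hbar)Q_\delta^-(\lambda)}.$$ Assume that $t_\delta(\lambda)=\prod_{a=1}^N(\lambda-\tau_a)$ with $|\mathrm{Im}\,\tau_a|<\hbar/2$,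 and that $\delta_1,\dots,\delta_N$ are the zeros, in the strip $|\mathrm{Im}\,z|<\hbar/2$, of the Hill determinant $\mathcal H$ associated with $t_\delta$. Here $\mathcal H(\lambda)$ is the limit, as $M\to\infty$, of the determinants of the truncations to the indices $-M\le m,n\le M$ of the tridiagonal matrix whose row $n\in\mathbb Z$ has diagonal entry $1$, entry $\rho^\hbar/t_\delta(\lambda+in\hbar)$ to the left of the diagonal and entry $1/t_\delta(\lambda+in\hbar)$ to its right; zeros are counted with multiplicity and before cancellation against the poles $\tau_a$, i.e. at each point of the strip the order of $\mathcal H$ is the number of $\delta$'s minus the number of $\tau$'s equal to that point. Then for every integer $k$ with $1\le k\le 2N-1$ the integral below converges absolutely, and $$\sum_{p=1}^N\tau_p^k=\sum_{p=1}^N\delta_p^k+k\int_{\mathbb R}\frac{d\mu}{2i\pi}\Big\{(\mu+i\tfrac\hbar2)^{k-1}-(\mu-i\tfrac\hbar2)^{k-1}\Big\}\ln\Big(1+\frac{\rho^\hbar\,Y_\delta(\mu)}{|\vartheta(\mu-i\hbar/2)|^2}\Big).$$ -/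

import Mathlib

open Complex MeasureTheory Filter Topology

noncomputable section

namespace TodaTBA

/-- The monic polynomial function `z ↦ ∏ₖ (z - rₖ)` with the family of roots `r`. It is used for
`ϑ` (roots `δₖ`) and for the transfer matrix eigenvalue `t` (roots `τₖ`). -/
def monic {N : ℕ} (r : Fin N → ℂ) (z : ℂ) : ℂ := ∏ k, (z - r k)

/-- The family `r` is invariant under complex conjugation, counting multiplicities. -/
def SelfConj {N : ℕ} (r : Fin N → ℂ) : Prop :=
  ∃ σ : Equiv.Perm (Fin N), ∀ k, (starRingEnd ℂ) (r k) = r (σ k)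

/-! ### The Hill determinant -/

/-- The doubly infinite tridiagonal matrix with rows indexed by `n ∈ ℤ`; the row `n` is
`…, 0, ρ^ℏ / t(z + i n ℏ), 1, 1 / t(z + i n ℏ), 0, …` with the entry `1` on the diagonal. -/
def hillMatrix (hbar ρ : ℝ) {N : ℕ} (τ : Fin N → ℂ) (z : ℂ) : Matrix ℤ ℤ ℂ :=
  Matrix.of fun m n =>
    if n = m then 1
    else if n = m + 1 then 1 / monic τ (z + I * m * hbar)
    else if n = m - 1 then ((ρ ^ hbar : ℝ) : ℂ) / monic τ (z + I * m * hbar)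
    else 0

/-- The Hill determinant: the limit, as `M → ∞`, of the determinants of the truncations of the
infinite matrix to the indices `-M ≤ m, n ≤ M`. -/
def hillDet (hbar ρ : ℝ) {N : ℕ} (τ : Fin N → ℂ) (z : ℂ) : ℂ :=
  limUnder atTop fun M : ℕ =>
    ((hillMatrix hbar ρ τ z).submatrix
      (fun i : Finset.Icc (-(M : ℤ)) (M : ℤ) => (i : ℤ))
      (fun i : Finset.Icc (-(M : ℤ)) (M : ℤ) => (i : ℤ))).det

/-- `δ` is the family of the `N` zeros, with multiplicities, of the Hill determinant built from
`t = ∏ (z - τₖ)`, in the strip `|Im z| < ℏ / 2`.  In that strip the poles of the Hill determinant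
are the `τₖ`; a zero sitting on a pole `τₖ` is counted before cancellation, so that at each point
the order of the Hill determinant is the number of `δ`'s minus the number of `τ`'s there. -/
def IsHillZeros (hbar ρ : ℝ) {N : ℕ} (τ δ : Fin N → ℂ) : Prop :=
  (∀ k, |(δ k).im| < hbar / 2) ∧
  ∀ z : ℂ, |z.im| < hbar / 2 →
    meromorphicOrderAt (hillDet hbar ρ τ) z =
      ((({a | δ a = z} : Set (Fin N)).ncard : ℤ) - (({a | τ a = z} : Set (Fin N)).ncard : ℤ) : ℤ)

/-! ### The nonlinear integral equation -/

/-- `K(x) = ℏ / (π (x² + ℏ²))`. -/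
def kernel (hbar x : ℝ) : ℝ := hbar / (Real.pi * (x ^ 2 + hbar ^ 2))

/-- `V(μ) = 1 + ρ^ℏ Y(μ) / |ϑ(μ - iℏ/2)|²`, where `ϑ = ∏ (z - δₖ)`. -/
def V (hbar ρ : ℝ) {N : ℕ} (δ : Fin N → ℂ) (Y : ℝ → ℝ) (μ : ℝ) : ℝ :=
  1 + ρ ^ hbar * Y μ / ‖monic δ ((μ : ℂ) - I * hbar / 2)‖ ^ 2

/-- `Y` solves the nonlinear integral equation on the real line, in the class of functions for
which `log Y` is continuous, nonnegative and bounded. -/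
structure IsNLIESolution (hbar ρ : ℝ) {N : ℕ} (δ : Fin N → ℂ) (Y : ℝ → ℝ) : Prop where
  pos : ∀ x, 0 < Y x
  continuous_log : Continuous fun x => Real.log (Y x)
  log_nonneg : ∀ x, 0 ≤ Real.log (Y x)
  log_bounded : ∃ C : ℝ, ∀ x, Real.log (Y x) ≤ C
  equation : ∀ x, Real.log (Y x) = ∫ μ : ℝ, kernel hbar (x - μ) * Real.log (V hbar ρ δ Y μ)

/-! ### The functions `v`, `Q` and `t` constructed from a solution `Y` -/

/-- `v_↑(z)`, given by its integral representation, valid for `Im z > -ℏ/2`. -/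
def vUp (hbar ρ : ℝ) {N : ℕ} (δ : Fin N → ℂ) (Y : ℝ → ℝ) (z : ℂ) : ℂ :=
  exp (-∫ μ : ℝ, 1 / (2 * Real.pi * I) * (1 / (z - μ + I * hbar / 2)) *
    (Real.log (V hbar ρ δ Y μ) : ℂ))

/-- `v_↓(z - iℏ)`, given by its integral representation, valid for `Im z < ℏ/2`. -/
def vDownShift (hbar ρ : ℝ) {N : ℕ} (δ : Fin N → ℂ) (Y : ℝ → ℝ) (z : ℂ) : ℂ :=
  exp (∫ μ : ℝ, 1 / (2 * Real.pi * I) * (1 / (z - μ - I * hbar / 2)) *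
    (Real.log (V hbar ρ δ Y μ) : ℂ))

open Classical in
/-- The continuation to an entire function of a function `f` given on the set `U` (it is unique as
soon as `U` is open and nonempty); if there is none, the value is `f` itself. -/
def entireContinuation (U : Set ℂ) (f : ℂ → ℂ) : ℂ → ℂ :=
  if h : ∃ F : ℂ → ℂ, Differentiable ℂ F ∧ Set.EqOn F f U then h.choose else f

/-- The entire function `Q_δ⁺`, continued from the half-plane `Im z > -ℏ/2`, where
`Q_δ⁺(z) = (κ g^N)^{-iz} ℏ^{iNz/ℏ} e^{-Nπz/ℏ} v_↑(z) / ∏ₖ Γ(1 - i(z - δₖ)/ℏ)`. -/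
def QPlus (hbar g κ : ℝ) {N : ℕ} (δ : Fin N → ℂ) (Y : ℝ → ℝ) : ℂ → ℂ :=
  entireContinuation {z | -(hbar / 2) < z.im} fun z =>
    ((κ * g ^ N : ℝ) : ℂ) ^ (-I * z) * (hbar : ℂ) ^ (I * N * z / hbar) *
      exp (-(N * Real.pi * z / hbar)) * vUp hbar (κ * g ^ (2 * N)) δ Y z /
        ∏ k, Gamma (1 - I * (z - δ k) / hbar)

/-- The entire function `Q_δ⁻`, continued from the half-plane `Im z < ℏ/2`, where
`Q_δ⁻(z) = g^{iNz} ℏ^{-iNz/ℏ} e^{-Nπz/ℏ} v_↓(z - iℏ) / ∏ₖ Γ(1 + i(z - δₖ)/ℏ)`. -/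
def QMinus (hbar g κ : ℝ) {N : ℕ} (δ : Fin N → ℂ) (Y : ℝ → ℝ) : ℂ → ℂ :=
  entireContinuation {z | z.im < hbar / 2} fun z =>
    (g : ℂ) ^ (I * N * z) * (hbar : ℂ) ^ (-(I * N * z / hbar)) *
      exp (-(N * Real.pi * z / hbar)) * vDownShift hbar (κ * g ^ (2 * N)) δ Y z /
        ∏ k, Gamma (1 + I * (z - δ k) / hbar)

/-- The quantum Wronskian `Q_δ⁺(z) Q_δ⁻(z + iℏ) - Q_δ⁺(z + iℏ) Q_δ⁻(z)`. -/
def wronskian (hbar g κ : ℝ) {N : ℕ} (δ : Fin N → ℂ) (Y : ℝ → ℝ) (z : ℂ) : ℂ :=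
  QPlus hbar g κ δ Y z * QMinus hbar g κ δ Y (z + I * hbar) -
    QPlus hbar g κ δ Y (z + I * hbar) * QMinus hbar g κ δ Y z

/-- The function `t_δ`, given by the quotient below where the quantum Wronskian does not vanish. -/
def tDelta (hbar g κ : ℝ) {N : ℕ} (δ : Fin N → ℂ) (Y : ℝ → ℝ) (z : ℂ) : ℂ :=
  (-I) ^ N * (((κ * g ^ N) ^ hbar : ℝ) : ℂ) *
    (QPlus hbar g κ δ Y (z - I * hbar) * QMinus hbar g κ δ Y (z + I * hbar) -
      QPlus hbar g κ δ Y (z + I * hbar) * QMinus hbar g κ δ Y (z - I * hbar)) /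
    wronskian hbar g κ δ Y z

/-- `t_δ` is the polynomial `∏ₐ (z - τₐ)`, i.e. the `τₐ` are the zeros of `t_δ`. -/
def IsZerosOfTDelta (hbar g κ : ℝ) {N : ℕ} (δ τ : Fin N → ℂ) (Y : ℝ → ℝ) : Prop :=
  ∀ z : ℂ, wronskian hbar g κ δ Y z ≠ 0 → tDelta hbar g κ δ Y z = monic τ z

end TodaTBA

end

noncomputable section

namespace TodaTBA

open Asymptotics

/-! ### Holomorphic dependence of integrals on a parameter -/

/-! Let `T(w) = ∫ log V(μ) / (2πi (w - μ)) dμ`. Then `v_↑(z) = exp (-T(z + iℏ/2))` and `v_↓(z - iℏ)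
= exp (T(z - iℏ/2))`. Partial fractions of the kernel turn the integral equation into `log Y(x) =
T(x - iℏ) - T(x + iℏ)`, so `V` extends holomorphically around the real line (`VExt`). Since `T`
jumps by `log V` there, `exp (-T)` continues downwards as `exp (-T) V`.

For `Q⁺` this continuation is a first order difference equation expressing `Q⁺(z)` through `Q⁺(z +
iℏ)`; iterating it makes `Q⁺` entire (`exists_entire_QPlus`), and conjugation gives `Q⁻`. The same
equation, multiplied by `Q⁻(z + iℏ)`, evaluates the quantum Wronskian as an elementary function
(`wronskian_eq`). Its values at `x` and `x - iℏ` eliminate `Q⁺(x - iℏ)` and `Q⁻(x + iℏ)` from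
`t_δ(x)`; what remains (`monic_mul_vUp_mul_vDownShift`) shows that `t v_↑ v_↓ / ϑ = 1 + O(x^(-2N))`
as `x → +∞`.

Taking logarithms, `log (t / ϑ) - T(x + iℏ/2) + T(x - iℏ/2) = O(x^(-2N))`. In powers of `1/x`, the
coefficients of `log (t / ϑ)` are differences of power sums of `δ` and `τ`, and those of `T` are
moments of `log V`, which exist to the required order because `log V = O(μ^(-2N))`. Comparing the
coefficients of `x^(-k)` for `k ≤ 2N - 1` gives the formula (`sum_pow_eq`). -/

/-- For holomorphic integrands a dominating function for `F` itself suffices: Cauchy's estimate on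
discs of radius `ε / 4` bounds the derivative. -/
theorem differentiableOn_integral_of_dominated {α : Type*} [MeasurableSpace α] {ν : Measure α}
    {U : Set ℂ} (hU : IsOpen U) {F : ℂ → α → ℂ} {B : α → ℝ} (hB : Integrable B ν)
    (hm : ∀ w ∈ U, AEStronglyMeasurable (F w) ν)
    (hd : ∀ᵐ s ∂ν, DifferentiableOn ℂ (fun w => F w s) U)
    (hb : ∀ᵐ s ∂ν, ∀ w ∈ U, ‖F w s‖ ≤ B s) :
    DifferentiableOn ℂ (fun w => ∫ s, F w s ∂ν) U := by
  intro w₀ hw₀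
  obtain ⟨ε, hε, hball⟩ := Metric.isOpen_iff.1 hU w₀ hw₀
  have hε2 : 0 < ε / 2 := by positivity
  have hsub : ∀ w ∈ Metric.ball w₀ (ε / 2), Metric.closedBall w (ε / 4) ⊆ U := by
    intro w hw x hx
    apply hball
    rw [Metric.mem_ball] at hw ⊢
    rw [Metric.mem_closedBall] at hx
    linarith [dist_triangle x w w₀]
  have hwU : ∀ w ∈ Metric.ball w₀ (ε / 2), w ∈ U := fun w hw =>
    hsub w hw (Metric.mem_closedBall_self (by positivity))
  have key := hasDerivAt_integral_of_dominated_loc_of_deriv_le (μ := ν) (F := F) (x₀ := w₀)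
    (F' := fun w s => deriv (fun w => F w s) w) (bound := fun s => B s / (ε / 4))
    (Metric.ball_mem_nhds w₀ hε2) ?_ ?_ ?_ ?_ ?_ ?_
  · exact key.2.differentiableAt.differentiableWithinAt
  · filter_upwards [hU.mem_nhds hw₀] with w hw using hm w hw
  · refine hB.mono' (hm _ hw₀) ?_
    filter_upwards [hb] with s hs using hs _ hw₀
  -- Measurability of the derivative in `s`: it is a limit of difference quotients along increments
  -- `u n → 0` that keep `w₀ + u n` inside `U`.
  · let u : ℕ → ℂ := fun n => ((ε / 4 / (n + 1) : ℝ) : ℂ)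
    have hu0 : ∀ n, u n ≠ 0 := by
      intro n
      simp only [u, ne_eq, ofReal_eq_zero]
      positivity
    have hu : Tendsto u atTop (𝓝[≠] 0) := by
      rw [tendsto_nhdsWithin_iff]
      refine ⟨?_, Eventually.of_forall hu0⟩
      have := (tendsto_one_div_add_atTop_nhds_zero_nat (𝕜 := ℝ)).const_mul (ε / 4)
      have h2 := (continuous_ofReal.tendsto _).comp this
      simp only [mul_zero, ofReal_zero] at h2
      refine h2.congr fun n => ?_
      simp [u, div_eq_mul_inv]
    have hun : ∀ n, w₀ + u n ∈ U := by
      intro n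
      apply hsub w₀ (Metric.mem_ball_self hε2)
      rw [Metric.mem_closedBall, dist_eq_norm, add_sub_cancel_left]
      simp only [u, norm_real, Real.norm_eq_abs]
      rw [abs_of_pos (by positivity)]
      apply div_le_self (by positivity)
      linarith [(Nat.cast_nonneg n : (0 : ℝ) ≤ n)]
    refine aestronglyMeasurable_of_tendsto_ae atTop
      (f := fun n s => (u n)⁻¹ • (F (w₀ + u n) s - F w₀ s)) ?_ ?_
    · intro n
      exact AEStronglyMeasurable.const_smul ((hm _ (hun n)).sub (hm _ hw₀)) ((u n)⁻¹)
    · filter_upwards [hd] with s hs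
      have h1 : HasDerivAt (fun w => F w s) (deriv (fun w => F w s) w₀) w₀ :=
        ((hs w₀ hw₀).differentiableAt (hU.mem_nhds hw₀)).hasDerivAt
      exact (hasDerivAt_iff_tendsto_slope_zero.1 h1).comp hu
  · filter_upwards [hd, hb] with s hs hbs w hw
    apply norm_deriv_le_of_forall_mem_sphere_norm_le (by positivity)
    · exact (hs.mono (hsub w hw)).diffContOnCl_ball subset_rfl
    · intro z hz
      exact hbs z (hsub w hw (Metric.sphere_subset_closedBall hz))
  · exact hB.div_const _
  · filter_upwards [hd] with s hs w hw
    exact ((hs w (hwU w hw)).differentiableAt (hU.mem_nhds (hwU w hw))).hasDerivAt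

/-! ### The Cauchy transform of a function on the real line -/

/-- The Cauchy transform `w ↦ ∫ f(μ) / (2πi (w - μ)) dμ`. -/
def cauchyTransform (f : ℝ → ℂ) (w : ℂ) : ℂ :=
  ∫ μ : ℝ, 1 / (2 * Real.pi * I) * (1 / (w - μ)) * f μ

theorem differentiableOn_integral_cauchy {f : ℝ → ℂ} {ν : Measure ℝ} (hf : Integrable f ν)
    {U : Set ℂ} (hU : IsOpen U) {ε : ℝ} (hε : 0 < ε)
    (hd : ∀ᵐ μ : ℝ ∂ν, ∀ w ∈ U, ε ≤ ‖w - μ‖) :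
    DifferentiableOn ℂ (fun w => ∫ μ : ℝ, 1 / (2 * Real.pi * I) * (1 / (w - μ)) * f μ ∂ν) U := by
  refine differentiableOn_integral_of_dominated hU
    (B := fun μ => ‖(1 / (2 * Real.pi * I) : ℂ)‖ * (1 / ε) * ‖f μ‖)
    (hf.norm.const_mul _) ?_ ?_ ?_
  · intro w _
    refine AEStronglyMeasurable.mul ?_ hf.aestronglyMeasurable
    refine Measurable.aestronglyMeasurable ?_
    fun_prop
  · filter_upwards [hd] with μ hμ w hw
    have : w - μ ≠ 0 := norm_pos_iff.1 (hε.trans_le (hμ w hw))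
    refine DifferentiableAt.differentiableWithinAt ?_
    fun_prop (disch := assumption)
  · filter_upwards [hd] with μ hμ w hw
    rw [norm_mul, norm_mul]
    gcongr
    rw [norm_div, norm_one]
    gcongr
    exact hμ w hw

theorem abs_im_le_norm_sub_ofReal (w : ℂ) (μ : ℝ) : |w.im| ≤ ‖w - μ‖ := by
  have := abs_im_le_norm (w - μ)
  simpa using this

theorem differentiableAt_cauchyTransform {f : ℝ → ℂ} (hf : Integrable f) {w : ℂ}
    (hw : w.im ≠ 0) : DifferentiableAt ℂ (cauchyTransform f) w := by
  have hw' : 0 < |w.im| := abs_pos.2 hw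
  have ho : IsOpen {z : ℂ | |w.im| / 2 < |z.im|} :=
    isOpen_lt continuous_const (continuous_abs.comp continuous_im)
  refine (differentiableOn_integral_cauchy hf ho (ε := |w.im| / 2) (by positivity) ?_
    ).differentiableAt (ho.mem_nhds ?_)
  · exact Eventually.of_forall fun μ z hz => le_of_lt (lt_of_lt_of_le hz
      (abs_im_le_norm_sub_ofReal z μ))
  · simp only [Set.mem_ofPred_eq]
    linarith

theorem norm_one_div_two_pi_I : ‖(1 / (2 * Real.pi * I) : ℂ)‖ = 1 / (2 * Real.pi) := by
  simp [abs_of_pos Real.pi_pos]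

theorem integrable_cauchy {f : ℝ → ℂ} (hf : Integrable f) {w : ℂ}
    (hw : w.im ≠ 0) : Integrable fun μ : ℝ => 1 / (2 * Real.pi * I) * (1 / (w - μ)) * f μ := by
  refine (hf.norm.const_mul (1 / (2 * Real.pi) * (1 / |w.im|))).mono' ?_ ?_
  · refine AEStronglyMeasurable.mul ?_ hf.aestronglyMeasurable
    refine Measurable.aestronglyMeasurable ?_
    fun_prop
  · refine Eventually.of_forall fun μ => ?_
    rw [norm_mul, norm_mul, norm_one_div_two_pi_I, norm_div, norm_one]
    have := abs_im_le_norm_sub_ofReal w μ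
    have h0 : 0 < |w.im| := abs_pos.2 hw
    gcongr

theorem norm_cauchyTransform_le {f : ℝ → ℂ} (hf : Integrable f) {w : ℂ}
    {ε : ℝ} (hε : 0 < ε) (hw : ε ≤ |w.im|) :
    ‖cauchyTransform f w‖ ≤ 1 / (2 * Real.pi) * (1 / ε) * ∫ μ, ‖f μ‖ := by
  rw [← integral_const_mul]
  refine norm_integral_le_of_norm_le (hf.norm.const_mul _) (Eventually.of_forall fun μ => ?_)
  rw [norm_mul, norm_mul, norm_one_div_two_pi_I, norm_div, norm_one]
  have := hw.trans (abs_im_le_norm_sub_ofReal w μ)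
  gcongr

theorem log_neg_of_im_pos {u : ℂ} (hu : 0 < u.im) : log (-u) = log u - Real.pi * I := by
  rw [log, log, norm_neg, arg_neg_eq_arg_sub_pi_of_im_pos hu]
  push_cast
  ring

theorem integral_one_div_sub {w : ℂ} (hw : w.im ≠ 0) (a b : ℝ) :
    ∫ μ in a..b, 1 / (w - μ) = log (w - a) - log (w - b) := by
  have hs : ∀ μ : ℝ, w - μ ∈ slitPlane := fun μ => by
    rw [mem_slitPlane_iff]
    right
    simpa using hw
  have hd : ∀ μ : ℝ, HasDerivAt (fun μ : ℝ => -log (w - μ)) (1 / (w - μ)) μ := by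
    intro μ
    have h1 : HasDerivAt (fun z : ℂ => -log (w - z)) (1 / (w - μ)) (μ : ℂ) := by
      have := (((hasDerivAt_id (μ : ℂ)).const_sub w).clog (hs μ)).neg
      refine this.congr_deriv ?_
      rw [neg_div, neg_neg, id]
    exact h1.comp_ofReal
  rw [intervalIntegral.integral_eq_sub_of_hasDerivAt (fun μ _ => hd μ)]
  · ring
  · apply Continuous.intervalIntegrable
    refine continuous_const.div (by fun_prop) fun μ => slitPlane_ne_zero (hs μ)

theorem differentiableOn_integral_dslope {g : ℂ → ℂ} {x₀ R : ℝ} (hR : 0 < R)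
    (hg : DifferentiableOn ℂ g (Metric.ball (x₀ : ℂ) R)) :
    DifferentiableOn ℂ (fun w => ∫ μ in (x₀ - R / 2)..(x₀ + R / 2), dslope g (μ : ℂ) w)
      (Metric.ball (x₀ : ℂ) (R / 2)) := by
  have hIoc : ∀ μ : ℝ, μ ∈ Set.uIoc (x₀ - R / 2) (x₀ + R / 2) →
      (μ : ℂ) ∈ Metric.closedBall (x₀ : ℂ) (R / 2) := by
    intro μ hμ
    rw [Set.uIoc_of_le (by linarith)] at hμ
    rw [Metric.mem_closedBall, dist_eq_norm, ← ofReal_sub, norm_real, Real.norm_eq_abs, abs_le]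
    constructor <;> linarith [hμ.1, hμ.2]
  have hsub : Metric.closedBall (x₀ : ℂ) (R / 2) ⊆ Metric.ball (x₀ : ℂ) R :=
    Metric.closedBall_subset_ball (by linarith)
  have hsub' : Metric.ball (x₀ : ℂ) (R / 2) ⊆ Metric.ball (x₀ : ℂ) R :=
    Metric.ball_subset_ball (by linarith)
  obtain ⟨C, hC⟩ : ∃ C, ∀ z ∈ Metric.closedBall (x₀ : ℂ) (R / 2), ‖deriv g z‖ ≤ C :=
    (isCompact_closedBall _ _).exists_bound_of_continuousOn
      (((hg.deriv Metric.isOpen_ball).continuousOn).mono hsub)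
  have hgd : ∀ z ∈ Metric.closedBall (x₀ : ℂ) (R / 2), DifferentiableAt ℂ g z := fun z hz =>
    (hg z (hsub hz)).differentiableAt (Metric.isOpen_ball.mem_nhds (hsub hz))
  have hbd : ∀ μ ∈ Metric.closedBall (x₀ : ℂ) (R / 2), ∀ w ∈ Metric.closedBall (x₀ : ℂ) (R / 2),
      -- The mean value inequality bounds `dslope` uniformly, including on the diagonal where it is
      -- the derivative.
      ‖dslope g μ w‖ ≤ C := by
    intro μ hμ w hw
    by_cases h : w = μ
    · rw [h, dslope_same]
      exact hC μ hμ
    · rw [dslope_of_ne _ h, slope_def_field, norm_div, div_le_iff₀ (norm_pos_iff.2 (sub_ne_zero.2 h))]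
      exact (convex_closedBall _ _).norm_image_sub_le_of_norm_deriv_le hgd hC hμ hw
  simp_rw [intervalIntegral.integral_of_le (show x₀ - R / 2 ≤ x₀ + R / 2 by linarith),
    ← Set.uIoc_of_le (show x₀ - R / 2 ≤ x₀ + R / 2 by linarith)]
  refine differentiableOn_integral_of_dominated Metric.isOpen_ball (B := fun _ => C)
    (integrableOn_const (by simp [Set.uIoc]) ) ?_ ?_ ?_
  · intro w hw
    have hc : ContinuousOn (fun μ : ℝ => dslope g w (μ : ℂ))
        (Set.uIoc (x₀ - R / 2) (x₀ + R / 2)) := by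
      have h1 : DifferentiableOn ℂ (dslope g w) (Metric.ball (x₀ : ℂ) R) :=
        (differentiableOn_dslope (Metric.isOpen_ball.mem_nhds (hsub' hw))).2 hg
      exact h1.continuousOn.comp continuous_ofReal.continuousOn fun μ hμ => hsub (hIoc μ hμ)
    refine (hc.aestronglyMeasurable measurableSet_uIoc).congr (Eventually.of_forall fun μ => ?_)
    by_cases h : w = μ
    · simp [h]
    · simp only [dslope_of_ne _ h, dslope_of_ne _ (Ne.symm h), slope_comm]
  · refine (ae_restrict_iff' measurableSet_uIoc).2 (Eventually.of_forall fun μ hμ => ?_)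
    exact ((differentiableOn_dslope (Metric.isOpen_ball.mem_nhds (hsub (hIoc μ hμ)))).2 hg).mono hsub'
  · refine (ae_restrict_iff' measurableSet_uIoc).2 (Eventually.of_forall fun μ hμ w hw => ?_)
    exact hbd μ (hIoc μ hμ) w (Metric.ball_subset_closedBall hw)

/-- The Cauchy transform of a density that is holomorphic near a real point extends from either
half plane across that point, and the two extensions differ by the density. -/
theorem exists_local_extension_cauchyTransform {f : ℝ → ℂ} (hf : Integrable f) {x₀ R : ℝ}
    (hR : 0 < R) {g : ℂ → ℂ} (hg : DifferentiableOn ℂ g (Metric.ball (x₀ : ℂ) R))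
    (hfg : ∀ x : ℝ, (x : ℂ) ∈ Metric.ball (x₀ : ℂ) R → g x = f x) :
    ∃ h : ℂ → ℂ, DifferentiableOn ℂ h (Metric.ball (x₀ : ℂ) (R / 4)) ∧
      (∀ w ∈ Metric.ball (x₀ : ℂ) (R / 4), 0 < w.im → h w = cauchyTransform f w) ∧
      ∀ w ∈ Metric.ball (x₀ : ℂ) (R / 4), w.im < 0 → h w = cauchyTransform f w - g w := by
  set a := x₀ - R / 2 with ha
  set b := x₀ + R / 2 with hb
  have hab : a ≤ b := by linarith
  have hIoc : ∀ μ : ℝ, μ ∈ Set.uIoc a b → (μ : ℂ) ∈ Metric.ball (x₀ : ℂ) R := by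
    intro μ hμ
    rw [Set.uIoc_of_le hab] at hμ
    rw [Metric.mem_ball, dist_eq_norm, ← ofReal_sub, norm_real, Real.norm_eq_abs, abs_lt]
    constructor <;> linarith [hμ.1, hμ.2]
  have hsub : Metric.ball (x₀ : ℂ) (R / 4) ⊆ Metric.ball (x₀ : ℂ) R :=
    Metric.ball_subset_ball (by linarith)
  have hre : ∀ w ∈ Metric.ball (x₀ : ℂ) (R / 4), |w.re - x₀| < R / 4 := by
    intro w hw
    rw [Metric.mem_ball, dist_eq_norm] at hw
    exact lt_of_le_of_lt (by simpa using abs_re_le_norm (w - x₀)) hw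
  -- Only `μ` near `x₀` is singular. There `g(μ) / (w - μ) = -dslope g μ w + g(w) / (w - μ)`: the
  -- first term integrates to a holomorphic function, the second to `g(w)` times a difference of
  -- logarithms.
  let c : ℂ := 1 / (2 * Real.pi * I)
  let T₁ : ℂ → ℂ := fun w => ∫ μ in (Set.uIoc a b)ᶜ, 1 / (2 * Real.pi * I) * (1 / (w - μ)) * f μ
  let D : ℂ → ℂ := fun w => ∫ μ in a..b, dslope g (μ : ℂ) w
  have hT₁ : DifferentiableOn ℂ T₁ (Metric.ball (x₀ : ℂ) (R / 4)) := by
    refine differentiableOn_integral_cauchy hf.integrableOn Metric.isOpen_ball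
      (ε := R / 4) (by positivity) ?_
    refine (ae_restrict_iff' measurableSet_uIoc.compl).2 (Eventually.of_forall fun μ hμ w hw => ?_)
    have h1 := abs_lt.1 (hre w hw)
    have h2 : |w.re - μ| ≤ ‖w - μ‖ := by simpa using abs_re_le_norm (w - μ)
    refine le_trans ?_ h2
    rw [Set.uIoc_of_le hab, Set.mem_compl_iff, Set.mem_Ioc, not_and_or, not_lt, not_le] at hμ
    rcases hμ with h | h
    · exact le_trans (by linarith [h1.1]) (le_abs_self _)
    · exact le_trans (by linarith [h1.2]) (neg_le_abs _)
  have hD : DifferentiableOn ℂ D (Metric.ball (x₀ : ℂ) (R / 4)) :=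
    (differentiableOn_integral_dslope hR hg).mono (Metric.ball_subset_ball (by linarith))
  have hsplit : ∀ w ∈ Metric.ball (x₀ : ℂ) (R / 4), w.im ≠ 0 → cauchyTransform f w =
      T₁ w + c * (-D w + g w * (log (w - a) - log (w - b))) := by
    intro w hw hwim
    have hne : ∀ μ : ℝ, w - μ ≠ 0 := fun μ h => hwim (by simpa using congrArg im h)
    have hne' : ∀ μ : ℝ, w ≠ μ := fun μ => sub_ne_zero.1 (hne μ)
    have h1 : cauchyTransform f w =
        (∫ μ in Set.uIoc a b, 1 / (2 * Real.pi * I) * (1 / (w - μ)) * f μ) + T₁ w :=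
      (integral_add_compl measurableSet_uIoc (integrable_cauchy hf hwim)).symm
    have hint : IntervalIntegrable (fun μ : ℝ => 1 / (w - μ)) volume a b := by
      apply Continuous.intervalIntegrable
      exact continuous_const.div (by fun_prop) fun μ => hne μ
    have h2 : (∫ μ in Set.uIoc a b, 1 / (2 * Real.pi * I) * (1 / (w - μ)) * f μ) =
        c * ∫ μ in a..b, (-dslope g (μ : ℂ) w + g w * (1 / (w - μ))) := by
      rw [intervalIntegral.integral_of_le hab, ← Set.uIoc_of_le hab, ← integral_const_mul]
      refine setIntegral_congr_fun measurableSet_uIoc fun μ hμ => ?_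
      rw [dslope_of_ne _ (hne' μ), slope_def_field, hfg μ (hIoc μ hμ)]
      have := hne μ
      simp only [c]
      field_simp
      ring
    have hint2 : IntervalIntegrable (fun μ : ℝ => dslope g (μ : ℂ) w) volume a b := by
      have : IntervalIntegrable (fun μ : ℝ => (g w - f μ) * (1 / (w - μ))) volume a b := by
        apply IntervalIntegrable.mul_continuousOn
        · exact intervalIntegrable_const.sub hf.intervalIntegrable
        · exact (continuous_const.div (by fun_prop) fun μ => hne μ).continuousOn
      refine this.congr fun μ hμ => ?_
      rw [dslope_of_ne _ (hne' μ), slope_def_field, hfg μ (hIoc μ hμ)]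
      ring
    have h3 : ∫ μ in a..b, (-dslope g (μ : ℂ) w + g w * (1 / (w - μ))) =
        (∫ μ in a..b, -dslope g (μ : ℂ) w) + ∫ μ in a..b, g w * (1 / (w - μ)) :=
      intervalIntegral.integral_add hint2.neg (hint.const_mul _)
    rw [h1, h2, h3, intervalIntegral.integral_neg, intervalIntegral.integral_const_mul,
      integral_one_div_sub hwim, add_comm]
  have hpi : (Real.pi : ℂ) ≠ 0 := ofReal_ne_zero.2 Real.pi_ne_zero
  -- Both `w - a` and `b - w` have positive real part on the small disc, so this expression is
  -- holomorphic across the axis. Rewriting `log (w - b)` as `log (b - w) ± πi` according to the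
  -- half plane produces the jump `2πi c g(w) = g(w)`.
  refine ⟨fun w => T₁ w + c * (-D w + g w * (log (w - a) - log (b - w) - Real.pi * I)),
    ?_, ?_, ?_⟩
  · have hgd := hg.mono hsub
    have hl1 : DifferentiableOn ℂ (fun w : ℂ => log (w - a)) (Metric.ball (x₀ : ℂ) (R / 4)) := by
      refine DifferentiableOn.clog (by fun_prop) fun w hw => ?_
      rw [mem_slitPlane_iff]
      left
      have := abs_lt.1 (hre w hw)
      simp only [sub_re, ofReal_re]
      linarith [this.1]
    have hl2 : DifferentiableOn ℂ (fun w : ℂ => log (b - w)) (Metric.ball (x₀ : ℂ) (R / 4)) := by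
      refine DifferentiableOn.clog (by fun_prop) fun w hw => ?_
      rw [mem_slitPlane_iff]
      left
      have := abs_lt.1 (hre w hw)
      simp only [sub_re, ofReal_re]
      linarith [this.2]
    exact hT₁.add ((hD.neg.add (hgd.mul ((hl1.sub hl2).sub_const _))).const_mul c)
  · intro w hw hwim
    simp only
    rw [hsplit w hw hwim.ne', show (b : ℂ) - w = -(w - b) by ring,
      log_neg_of_im_pos (by simpa using hwim)]
    ring
  · intro w hw hwim
    simp only
    rw [hsplit w hw hwim.ne, show w - (b : ℂ) = -(b - w) by ring,
      log_neg_of_im_pos (by simpa using hwim)]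
    have : c * (2 * Real.pi * I) = 1 := by
      simp only [c]
      field_simp
    linear_combination (-g w) * this

/-! ### Continuation by means of a first order difference equation -/

open Classical in
/-- Successive continuations of `f` from the half plane `c < Im z` by means of the equation
`F(z) = A(z) + B(z) F(z + i ℏ)`; each step gains a strip of width `ℏ`. -/
def stepContinuation (c hbar : ℝ) (f A B : ℂ → ℂ) : ℕ → ℂ → ℂ
  | 0 => f
  | n + 1 => fun z =>
      if c < z.im then f z
      else if z.im = c then limUnder (𝓝[{w | c < w.im}] z) f
      else A z + B z * stepContinuation c hbar f A B n (z + I * hbar)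

section

variable {c hbar : ℝ} {f A B : ℂ → ℂ}

theorem stepContinuation_of_lt (n : ℕ) {z : ℂ} (hz : c < z.im) :
    stepContinuation c hbar f A B n z = f z := by
  cases n <;> simp [stepContinuation, hz]

theorem stepContinuation_succ_of_lt (n : ℕ) {z : ℂ} (hz : z.im < c) :
    stepContinuation c hbar f A B (n + 1) z =
      A z + B z * stepContinuation c hbar f A B n (z + I * hbar) := by
  simp [stepContinuation, hz.not_gt, hz.ne]

theorem stepContinuation_succ_of_eq (n : ℕ) {z : ℂ} (hz : z.im = c) :
    stepContinuation c hbar f A B (n + 1) z = limUnder (𝓝[{w | c < w.im}] z) f := by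
  simp [stepContinuation, hz]

theorem add_I_mul_im (z : ℂ) (h : ℝ) : (z + I * h).im = z.im + h := by simp

theorem stepContinuation_stable (n : ℕ) {z : ℂ} (hz : c - n * hbar < z.im) :
    stepContinuation c hbar f A B (n + 1) z = stepContinuation c hbar f A B n z := by
  induction n generalizing z with
  | zero =>
    have hz' : c < z.im := by simpa using hz
    rw [stepContinuation_of_lt _ hz', stepContinuation_of_lt _ hz']
  | succ n ih =>
    rcases lt_trichotomy z.im c with h | h | h
    · rw [stepContinuation_succ_of_lt _ h, stepContinuation_succ_of_lt _ h, ih]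
      rw [add_I_mul_im]
      push_cast at hz
      linarith
    · rw [stepContinuation_succ_of_eq _ h, stepContinuation_succ_of_eq _ h]
    · rw [stepContinuation_of_lt _ h, stepContinuation_of_lt _ h]

theorem stepContinuation_eq_of_le (hh : 0 < hbar) {n m : ℕ} (hnm : n ≤ m) {z : ℂ}
    (hz : c - n * hbar < z.im) :
    stepContinuation c hbar f A B m z = stepContinuation c hbar f A B n z := by
  induction m, hnm using Nat.le_induction with
  | base => rfl
  | succ m hm ih =>
    rw [stepContinuation_stable, ih]
    have : (n : ℝ) ≤ m := Nat.cast_le.2 hm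
    nlinarith

theorem limUnder_eq_of_eqOn_upper {z : ℂ} (hz : z.im = c) {h : ℂ → ℂ} (hh : ContinuousAt h z)
    (he : ∀ᶠ w in 𝓝 z, c < w.im → h w = f w) :
    limUnder (𝓝[{w | c < w.im}] z) f = h z := by
  have : (𝓝[{w : ℂ | c < w.im}] z).NeBot := by
    rw [← mem_closure_iff_nhdsWithin_neBot, closure_setOfPred_lt_im]
    exact hz.ge
  refine Tendsto.limUnder_eq ?_
  refine (hh.tendsto.mono_left nhdsWithin_le_nhds).congr' ?_
  filter_upwards [nhdsWithin_le_nhds he, self_mem_nhdsWithin] with w h1 h2 using h1 h2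

theorem isOpen_lt_im (c : ℝ) : IsOpen {z : ℂ | c < z.im} :=
  isOpen_lt continuous_const continuous_im

theorem isOpen_im_lt (c : ℝ) : IsOpen {z : ℂ | z.im < c} :=
  isOpen_lt continuous_im continuous_const

/-- The hypothesis `hloc` is needed only on the line `Im z = c`. Holomorphy across the lower lines
`Im z = c - nℏ` is inherited through the shift by `iℏ` from the previous stage. -/
theorem differentiableAt_stepContinuation (hh : 0 < hbar)
    (hf : DifferentiableOn ℂ f {z | c < z.im}) (hA : DifferentiableOn ℂ A {z | z.im < c})
    (hB : DifferentiableOn ℂ B {z | z.im < c})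
    (hloc : ∀ z₀ : ℂ, z₀.im = c → ∃ r > 0, ∃ h : ℂ → ℂ,
      DifferentiableOn ℂ h (Metric.ball z₀ r) ∧
      (∀ z ∈ Metric.ball z₀ r, c < z.im → h z = f z) ∧
      ∀ z ∈ Metric.ball z₀ r, z.im < c → h z = A z + B z * f (z + I * hbar))
    (n : ℕ) {z : ℂ} (hz : c - n * hbar < z.im) :
    DifferentiableAt ℂ (stepContinuation c hbar f A B n) z := by
  have hup : ∀ (n : ℕ) {z : ℂ}, c < z.im →
      DifferentiableAt ℂ (stepContinuation c hbar f A B n) z := by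
    intro n z h
    refine ((hf z h).differentiableAt ((isOpen_lt_im c).mem_nhds h)).congr_of_eventuallyEq ?_
    filter_upwards [(isOpen_lt_im c).mem_nhds h] with w hw using stepContinuation_of_lt n hw
  induction n generalizing z with
  | zero => exact hup 0 (by simpa using hz)
  | succ n ih =>
    rcases lt_trichotomy z.im c with h | h | h
    · have hz' : c - n * hbar < (z + I * hbar).im := by
        rw [add_I_mul_im]
        push_cast at hz
        linarith
      have hn := (isOpen_im_lt c).mem_nhds h
      have h1 : DifferentiableAt ℂ
          (fun z => A z + B z * stepContinuation c hbar f A B n (z + I * hbar)) z := by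
        refine ((hA z h).differentiableAt hn).add (((hB z h).differentiableAt hn).mul ?_)
        exact (ih hz').comp z (differentiableAt_id.add_const _)
      refine h1.congr_of_eventuallyEq ?_
      filter_upwards [hn] with w hw using stepContinuation_succ_of_lt n hw
    · obtain ⟨r, hr, k, hk, hk1, hk2⟩ := hloc z h
      have hb := Metric.ball_mem_nhds z hr
      refine ((hk z (Metric.mem_ball_self hr)).differentiableAt hb).congr_of_eventuallyEq ?_
      -- Close enough to the line, `w + iℏ` already lies in the half plane where every stage equals
      -- `f`.
      have hn : {w : ℂ | c - hbar < w.im} ∈ 𝓝 z := (isOpen_lt_im _).mem_nhds (by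
        simp only [Set.mem_ofPred_eq]; linarith)
      filter_upwards [hb, hn] with w hw hwn
      rcases lt_trichotomy w.im c with hw' | hw' | hw'
      · rw [stepContinuation_succ_of_lt _ hw', hk2 w hw hw', stepContinuation_of_lt]
        rw [add_I_mul_im]
        have : c - hbar < w.im := hwn
        linarith
      · rw [stepContinuation_succ_of_eq _ hw']
        have hbw := Metric.isOpen_ball.mem_nhds hw
        refine limUnder_eq_of_eqOn_upper hw' ((hk w hw).differentiableAt hbw).continuousAt ?_
        filter_upwards [hbw] with u hu using hk1 u hu
      · rw [stepContinuation_of_lt _ hw', hk1 w hw hw']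
    · exact hup _ h

/-- Each point is reached after finitely many steps and later stages agree there, so the stages
glue. -/
theorem exists_entire_solution_of_step (hh : 0 < hbar)
    (hf : DifferentiableOn ℂ f {z | c < z.im}) (hA : DifferentiableOn ℂ A {z | z.im < c})
    (hB : DifferentiableOn ℂ B {z | z.im < c})
    (hloc : ∀ z₀ : ℂ, z₀.im = c → ∃ r > 0, ∃ h : ℂ → ℂ,
      DifferentiableOn ℂ h (Metric.ball z₀ r) ∧
      (∀ z ∈ Metric.ball z₀ r, c < z.im → h z = f z) ∧
      ∀ z ∈ Metric.ball z₀ r, z.im < c → h z = A z + B z * f (z + I * hbar)) :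
    ∃ F : ℂ → ℂ, Differentiable ℂ F ∧ Set.EqOn F f {z | c < z.im} ∧
      ∀ z : ℂ, z.im < c → F z = A z + B z * F (z + I * hbar) := by
  have hex : ∀ z : ℂ, ∃ n : ℕ, c - n * hbar < z.im := by
    intro z
    obtain ⟨n, hn⟩ := exists_nat_gt ((c - z.im) / hbar)
    rw [div_lt_iff₀ hh] at hn
    exact ⟨n, by linarith⟩
  choose N hN using hex
  let G := stepContinuation c hbar f A B
  have hG : ∀ (n : ℕ) (z : ℂ), c - n * hbar < z.im → G (N z) z = G n z := by
    intro n z hz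
    rcases le_total n (N z) with h | h
    · exact stepContinuation_eq_of_le hh h hz
    · exact (stepContinuation_eq_of_le hh h (hN z)).symm
  refine ⟨fun z => G (N z) z, ?_, ?_, ?_⟩
  · intro z
    refine (differentiableAt_stepContinuation hh hf hA hB hloc (N z) (hN z)).congr_of_eventuallyEq ?_
    filter_upwards [(isOpen_lt_im _).mem_nhds (hN z)] with w hw using hG _ _ hw
  · intro z hz
    exact stepContinuation_of_lt _ hz
  · intro z hz
    have h1 : c - (N z : ℝ) * hbar < (z + I * hbar).im := by
      rw [add_I_mul_im]
      linarith [hN z]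
    have h2 : c - ((N z + 1 : ℕ) : ℝ) * hbar < z.im := by
      push_cast
      linarith [hN z]
    simp only
    rw [hG _ _ h1, hG _ _ h2]
    exact stepContinuation_succ_of_lt _ hz

end

/-! ### Bounds for the density `log V` -/

theorem exists_le_norm_ofReal_sub {u : ℂ} (hu : u.im ≠ 0) :
    ∃ c > 0, ∀ μ : ℝ, c * (1 + |μ|) ≤ ‖(μ : ℂ) - u‖ := by
  have hd : 0 < |u.im| := abs_pos.2 hu
  -- The constant combines two lower bounds for the distance: `|Im u|`, good for bounded `μ`, and
  -- `|μ| - ‖u‖`, good for large `μ`.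
  refine ⟨|u.im| / (1 + ‖u‖ + |u.im|), by positivity, fun μ => ?_⟩
  rw [div_mul_eq_mul_div, div_le_iff₀ (by positivity)]
  have h1 : |u.im| ≤ ‖(μ : ℂ) - u‖ := by simpa using abs_im_le_norm ((μ : ℂ) - u)
  have h2 : |μ| - ‖u‖ ≤ ‖(μ : ℂ) - u‖ := by simpa using norm_sub_norm_le (μ : ℂ) u
  nlinarith [norm_nonneg u]

theorem exists_le_norm_monic {N : ℕ} (r : Fin N → ℂ) (s : ℂ) (h : ∀ k, (r k - s).im ≠ 0) :
    ∃ c > 0, ∀ μ : ℝ, c * (1 + |μ|) ^ N ≤ ‖monic r (μ + s)‖ := by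
  choose c hc hcμ using fun k => exists_le_norm_ofReal_sub (h k)
  refine ⟨∏ k, c k, Finset.prod_pos fun k _ => hc k, fun μ => ?_⟩
  rw [monic, norm_prod]
  calc (∏ k, c k) * (1 + |μ|) ^ N = ∏ k : Fin N, c k * (1 + |μ|) := by
        rw [Finset.prod_mul_distrib]
        simp
    _ ≤ _ := by
        refine Finset.prod_le_prod (fun k _ => by have := hc k; positivity) fun k _ => ?_
        rw [add_sub_assoc, ← neg_sub (r k) s, ← sub_eq_add_neg]
        exact hcμ k μ

theorem monic_ne_zero_iff {N : ℕ} {r : Fin N → ℂ} {z : ℂ} :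
    monic r z ≠ 0 ↔ ∀ k, z ≠ r k := by
  simp [monic, Finset.prod_ne_zero_iff, sub_ne_zero]

theorem differentiable_monic {N : ℕ} (r : Fin N → ℂ) : Differentiable ℂ (monic r) := by
  unfold monic
  fun_prop

theorem SelfConj.conj_monic {N : ℕ} {r : Fin N → ℂ} (h : SelfConj r) (z : ℂ) :
    (starRingEnd ℂ) (monic r z) = monic r ((starRingEnd ℂ) z) := by
  obtain ⟨σ, hσ⟩ := h
  simp only [monic, map_prod, map_sub, hσ]
  exact Equiv.prod_comp σ fun k => (starRingEnd ℂ) z - r k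

section

variable {hbar ρ : ℝ} {N : ℕ} {δ : Fin N → ℂ} {Y : ℝ → ℝ}

theorem monic_sub_ne_zero (him : ∀ k, |(δ k).im| < hbar / 2) (μ : ℝ) :
    monic δ ((μ : ℂ) - I * hbar / 2) ≠ 0 := by
  rw [monic_ne_zero_iff]
  intro k h
  have := congrArg im h
  have h2 := abs_lt.1 (him k)
  simp at this
  linarith [h2.1]

theorem monic_add_ne_zero (him : ∀ k, |(δ k).im| < hbar / 2) (μ : ℝ) :
    monic δ ((μ : ℂ) + I * hbar / 2) ≠ 0 := by
  rw [monic_ne_zero_iff]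
  intro k h
  have := congrArg im h
  have h2 := abs_lt.1 (him k)
  simp at this
  linarith [h2.2]

theorem one_le_V (hρ : 0 < ρ) (hY : IsNLIESolution hbar ρ δ Y) (μ : ℝ) :
    1 ≤ V hbar ρ δ Y μ := by
  have := hY.pos μ
  unfold V
  have : 0 ≤ ρ ^ hbar * Y μ / ‖monic δ ((μ : ℂ) - I * hbar / 2)‖ ^ 2 := by positivity
  linarith

theorem continuous_V (him : ∀ k, |(δ k).im| < hbar / 2) (hY : IsNLIESolution hbar ρ δ Y) :
    Continuous (V hbar ρ δ Y) := by
  have hYc : Continuous Y := by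
    have := Real.continuous_exp.comp hY.continuous_log
    refine this.congr fun x => ?_
    simp [Real.exp_log (hY.pos x)]
  have hm : Continuous fun μ : ℝ => monic δ ((μ : ℂ) - I * hbar / 2) :=
    (differentiable_monic δ).continuous.comp (by fun_prop)
  unfold V
  refine continuous_const.add ((continuous_const.mul hYc).div (hm.norm.pow 2) fun μ => ?_)
  exact pow_ne_zero 2 (norm_ne_zero_iff.2 (monic_sub_ne_zero him μ))

/-- The density `log V`, as a complex-valued function. -/
def logV (hbar ρ : ℝ) {N : ℕ} (δ : Fin N → ℂ) (Y : ℝ → ℝ) (μ : ℝ) : ℂ :=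
  (Real.log (V hbar ρ δ Y μ) : ℂ)

theorem continuous_logV (hρ : 0 < ρ) (him : ∀ k, |(δ k).im| < hbar / 2)
    (hY : IsNLIESolution hbar ρ δ Y) : Continuous (logV hbar ρ δ Y) :=
  continuous_ofReal.comp ((continuous_V him hY).log fun μ =>
    (zero_lt_one.trans_le (one_le_V hρ hY μ)).ne')

/-- From `log V ≤ V - 1`, with `Y` bounded and `|ϑ|` growing like `|μ|^N` on the line `Im = -ℏ/2`.
The exponent `2 * N` is what limits the number of available moments. -/
theorem exists_norm_logV_le (hρ : 0 < ρ) (him : ∀ k, |(δ k).im| < hbar / 2)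
    (hY : IsNLIESolution hbar ρ δ Y) :
    ∃ C > 0, ∀ μ, ‖logV hbar ρ δ Y μ‖ ≤ C / (1 + |μ|) ^ (2 * N) := by
  obtain ⟨C, hC⟩ := hY.log_bounded
  obtain ⟨c, hc, hcm⟩ := exists_le_norm_monic δ (-(I * hbar / 2)) (fun k h => by
    have h2 := abs_lt.1 (him k)
    simp at h
    linarith [h2.1])
  refine ⟨ρ ^ hbar * Real.exp C / c ^ 2, by positivity, fun μ => ?_⟩
  have h1 := one_le_V hρ hY μ
  have hYle : Y μ ≤ Real.exp C := by
    rw [← Real.exp_log (hY.pos μ)]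
    exact Real.exp_le_exp.2 (hC μ)
  have hYpos := hY.pos μ
  rw [logV, norm_real, Real.norm_of_nonneg (Real.log_nonneg h1)]
  refine (Real.log_le_sub_one_of_pos (by linarith)).trans ?_
  have h2 : c * (1 + |μ|) ^ N ≤ ‖monic δ ((μ : ℂ) - I * hbar / 2)‖ := hcm μ
  calc V hbar ρ δ Y μ - 1 = ρ ^ hbar * Y μ / ‖monic δ ((μ : ℂ) - I * hbar / 2)‖ ^ 2 := by
        simp [V]
    _ ≤ ρ ^ hbar * Real.exp C / (c * (1 + |μ|) ^ N) ^ 2 := by gcongr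
    _ = _ := by
        rw [mul_pow, ← pow_mul, mul_comm N 2, div_div]

theorem integrable_one_add_abs_rpow {r : ℝ} (hr : 1 < r) :
    Integrable fun μ : ℝ => (1 + |μ|) ^ (-r) := by
  have := integrable_one_add_norm (E := ℝ) (μ := volume) (r := r) (by simpa using hr)
  simpa using this

theorem integrable_one_div_one_add_abs_pow {n : ℕ} (hn : 2 ≤ n) :
    Integrable fun μ : ℝ => 1 / (1 + |μ|) ^ n := by
  refine (integrable_one_add_abs_rpow (r := n) (by exact_mod_cast hn)).congr
    (Eventually.of_forall fun μ => ?_)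
  simp only
  rw [Real.rpow_neg (by positivity), Real.rpow_natCast, one_div]

theorem integrable_logV (hN : N ≠ 0) (hρ : 0 < ρ) (him : ∀ k, |(δ k).im| < hbar / 2)
    (hY : IsNLIESolution hbar ρ δ Y) : Integrable (logV hbar ρ δ Y) := by
  obtain ⟨C, _, hCμ⟩ := exists_norm_logV_le hρ him hY
  refine ((integrable_one_div_one_add_abs_pow (n := 2 * N) (by lia)).const_mul C).mono'
    (continuous_logV hρ him hY).aestronglyMeasurable (Eventually.of_forall fun μ => ?_)
  rw [mul_one_div]
  exact hCμ μ

/-! ### The Cauchy transform of `log V` and the holomorphic extension of `V` -/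

/-- The Cauchy transform of `log V`. -/
def cauchyLogV (hbar ρ : ℝ) {N : ℕ} (δ : Fin N → ℂ) (Y : ℝ → ℝ) : ℂ → ℂ :=
  cauchyTransform (logV hbar ρ δ Y)

theorem vUp_eq (z : ℂ) :
    vUp hbar ρ δ Y z = exp (-cauchyLogV hbar ρ δ Y (z + I * hbar / 2)) := by
  simp only [vUp, cauchyLogV, cauchyTransform, logV, sub_add_eq_add_sub]

theorem vDownShift_eq (z : ℂ) :
    vDownShift hbar ρ δ Y z = exp (cauchyLogV hbar ρ δ Y (z - I * hbar / 2)) := by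
  simp only [vDownShift, cauchyLogV, cauchyTransform, logV, sub_right_comm]

/-- The kernel is `(1 / 2πi) (1 / (x - iℏ) - 1 / (x + iℏ))`, which makes the integral equation a
functional relation for `T`. -/
theorem ofReal_log_Y (hh : 0 < hbar) (hN : N ≠ 0) (hρ : 0 < ρ)
    (him : ∀ k, |(δ k).im| < hbar / 2) (hY : IsNLIESolution hbar ρ δ Y) (x : ℝ) :
    (Real.log (Y x) : ℂ) =
      cauchyLogV hbar ρ δ Y (x - I * hbar) - cauchyLogV hbar ρ δ Y (x + I * hbar) := by
  have hi := integrable_logV hN hρ him hY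
  have h1 : ((x : ℂ) - I * hbar).im ≠ 0 := by simp [hh.ne']
  have h2 : ((x : ℂ) + I * hbar).im ≠ 0 := by simp [hh.ne']
  rw [hY.equation x, cauchyLogV, cauchyTransform, cauchyTransform,
    ← integral_sub (integrable_cauchy hi h1) (integrable_cauchy hi h2), ← integral_complex_ofReal]
  refine integral_congr_ae (Eventually.of_forall fun μ => ?_)
  have hne1 : (x : ℂ) - I * hbar - μ ≠ 0 := fun h => h1 (by simpa using congrArg im h)
  have hne2 : (x : ℂ) + I * hbar - μ ≠ 0 := fun h => h2 (by simpa using congrArg im h)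
  have hpi : (Real.pi : ℂ) ≠ 0 := ofReal_ne_zero.2 Real.pi_ne_zero
  have hprod : ((x : ℂ) - I * hbar - μ) * ((x : ℂ) + I * hbar - μ) =
      ((x : ℂ) - μ) ^ 2 + hbar ^ 2 := by
    linear_combination (-(hbar : ℂ) ^ 2) * I_sq
  have hne3 : ((x : ℂ) - μ) ^ 2 + hbar ^ 2 ≠ 0 := hprod ▸ mul_ne_zero hne1 hne2
  have key : (1 / ((x : ℂ) - I * hbar - μ) - 1 / ((x : ℂ) + I * hbar - μ)) =
      2 * I * hbar / (((x : ℂ) - μ) ^ 2 + hbar ^ 2) := by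
    rw [div_sub_div _ _ hne1 hne2, hprod]
    ring
  simp only [kernel, logV]
  rw [← sub_mul, ← mul_sub, key]
  push_cast
  field_simp

/-- The extension of `V` to a complex neighbourhood of the real line. -/
def VExt (hbar ρ : ℝ) {N : ℕ} (δ : Fin N → ℂ) (Y : ℝ → ℝ) (w : ℂ) : ℂ :=
  1 + ((ρ ^ hbar : ℝ) : ℂ) *
    exp (cauchyLogV hbar ρ δ Y (w - I * hbar) - cauchyLogV hbar ρ δ Y (w + I * hbar)) /
      (monic δ (w - I * hbar / 2) * monic δ (w + I * hbar / 2))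

/-- Conjugation invariance of `δ` turns `|ϑ(x - iℏ/2)|²` into the holomorphic product `ϑ(x - iℏ/2)
ϑ(x + iℏ/2)`. -/
theorem VExt_ofReal (hh : 0 < hbar) (hN : N ≠ 0) (hρ : 0 < ρ) (hδ : SelfConj δ)
    (him : ∀ k, |(δ k).im| < hbar / 2) (hY : IsNLIESolution hbar ρ δ Y) (x : ℝ) :
    VExt hbar ρ δ Y x = V hbar ρ δ Y x := by
  have h1 : monic δ ((x : ℂ) + I * hbar / 2) =
      (starRingEnd ℂ) (monic δ ((x : ℂ) - I * hbar / 2)) := by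
    rw [hδ.conj_monic]
    congr 1
    simp only [map_sub, map_div₀, map_mul, conj_I, conj_ofReal, map_ofNat]
    ring
  rw [VExt, ← ofReal_log_Y hh hN hρ him hY, ← ofReal_exp, Real.exp_log (hY.pos x), h1,
    mul_conj, normSq_eq_norm_sq, V]
  push_cast
  rfl

theorem differentiableAt_cauchyLogV (hN : N ≠ 0) (hρ : 0 < ρ)
    (him : ∀ k, |(δ k).im| < hbar / 2) (hY : IsNLIESolution hbar ρ δ Y) {w : ℂ} (hw : w.im ≠ 0) :
    DifferentiableAt ℂ (cauchyLogV hbar ρ δ Y) w :=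
  differentiableAt_cauchyTransform (integrable_logV hN hρ him hY) hw

theorem differentiableAt_VExt (hN : N ≠ 0) (hρ : 0 < ρ) (him : ∀ k, |(δ k).im| < hbar / 2)
    (hY : IsNLIESolution hbar ρ δ Y) {w : ℂ} (hw : |w.im| < hbar)
    (h1 : monic δ (w - I * hbar / 2) ≠ 0) (h2 : monic δ (w + I * hbar / 2) ≠ 0) :
    DifferentiableAt ℂ (VExt hbar ρ δ Y) w := by
  have hw' := abs_lt.1 hw
  have hT := fun {u : ℂ} => differentiableAt_cauchyLogV (w := u) hN hρ him hY
  have hm := differentiable_monic δ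
  have d1 : DifferentiableAt ℂ (fun w => cauchyLogV hbar ρ δ Y (w - I * hbar)) w := by
    refine DifferentiableAt.comp w (hT ?_) (by fun_prop)
    simp only [sub_im, mul_im, I_re, I_im, ofReal_re, ofReal_im]
    linarith [hw'.2]
  have d2 : DifferentiableAt ℂ (fun w => cauchyLogV hbar ρ δ Y (w + I * hbar)) w := by
    refine DifferentiableAt.comp w (hT ?_) (by fun_prop)
    simp only [add_im, mul_im, I_re, I_im, ofReal_re, ofReal_im]
    linarith [hw'.1]
  unfold VExt
  refine (((d1.sub d2).cexp.const_mul _).div (DifferentiableAt.mul ?_ ?_)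
    (mul_ne_zero h1 h2)).const_add _
  · exact (hm _).comp w (by fun_prop)
  · exact (hm _).comp w (by fun_prop)

theorem exists_ball_VExt (hh : 0 < hbar) (hN : N ≠ 0) (hρ : 0 < ρ) (hδ : SelfConj δ)
    (him : ∀ k, |(δ k).im| < hbar / 2) (hY : IsNLIESolution hbar ρ δ Y) (x : ℝ) :
    ∃ R > 0, ∀ w ∈ Metric.ball (x : ℂ) R, |w.im| < hbar ∧ monic δ (w - I * hbar / 2) ≠ 0 ∧
      monic δ (w + I * hbar / 2) ≠ 0 ∧ VExt hbar ρ δ Y w ∈ slitPlane := by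
  have hm := (differentiable_monic δ).continuous
  have e1 : ∀ᶠ w : ℂ in 𝓝 (x : ℂ), |w.im| < hbar :=
    (isOpen_lt (continuous_abs.comp continuous_im) continuous_const).mem_nhds (by simpa using hh)
  have c2 : Continuous fun w : ℂ => monic δ (w - I * hbar / 2) := hm.comp (by fun_prop)
  have c3 : Continuous fun w : ℂ => monic δ (w + I * hbar / 2) := hm.comp (by fun_prop)
  have e2 := c2.continuousAt.eventually_ne (monic_sub_ne_zero him x)
  have e3 := c3.continuousAt.eventually_ne (monic_add_ne_zero him x)
  have hd : DifferentiableAt ℂ (VExt hbar ρ δ Y) x :=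
    differentiableAt_VExt hN hρ him hY (by simpa using hh) (monic_sub_ne_zero him x)
      (monic_add_ne_zero him x)
  -- Since `V ≥ 1` on the axis, the principal logarithm of the extension is holomorphic nearby.
  have hmem : VExt hbar ρ δ Y x ∈ slitPlane := by
    rw [VExt_ofReal hh hN hρ hδ him hY, ofReal_mem_slitPlane]
    linarith [one_le_V hρ hY x]
  have e4 := hd.continuousAt.eventually_mem (isOpen_slitPlane.mem_nhds hmem)
  obtain ⟨R, hR, h⟩ := Metric.eventually_nhds_iff_ball.1 (e1.and (e2.and (e3.and e4)))
  exact ⟨R, hR, h⟩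

/-- Across each real point, `exp (-T)` continues from the upper half plane to `exp (-T) V` in the
lower half plane, where `T` is the Cauchy transform of `log V`. -/
theorem exists_local_extension_exp_cauchyLogV (hh : 0 < hbar) (hN : N ≠ 0) (hρ : 0 < ρ)
    (hδ : SelfConj δ) (him : ∀ k, |(δ k).im| < hbar / 2) (hY : IsNLIESolution hbar ρ δ Y)
    (x : ℝ) :
    ∃ R > 0, ∃ h : ℂ → ℂ, DifferentiableOn ℂ h (Metric.ball (x : ℂ) R) ∧
      ∀ w ∈ Metric.ball (x : ℂ) R, monic δ (w - I * hbar / 2) ≠ 0 ∧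
        monic δ (w + I * hbar / 2) ≠ 0 ∧
        (0 < w.im → h w = exp (-cauchyLogV hbar ρ δ Y w)) ∧
        (w.im < 0 → h w = exp (-cauchyLogV hbar ρ δ Y w) * VExt hbar ρ δ Y w) := by
  obtain ⟨R, hR, hball⟩ := exists_ball_VExt hh hN hρ hδ him hY x
  have hg : DifferentiableOn ℂ (fun w => log (VExt hbar ρ δ Y w)) (Metric.ball (x : ℂ) R) := by
    intro w hw
    obtain ⟨h1, h2, h3, h4⟩ := hball w hw
    exact ((differentiableAt_VExt hN hρ him hY h1 h2 h3).clog h4).differentiableWithinAt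
  obtain ⟨h, hd, hup, hlo⟩ := exists_local_extension_cauchyTransform
    (integrable_logV hN hρ him hY) hR hg (fun y _ => by
      rw [VExt_ofReal hh hN hρ hδ him hY, logV, ofReal_log]
      linarith [one_le_V hρ hY y])
  refine ⟨R / 4, by positivity, fun w => exp (-h w), hd.neg.cexp, fun w hw => ?_⟩
  obtain ⟨h1, h2, h3, h4⟩ := hball w (Metric.ball_subset_ball (by linarith) hw)
  refine ⟨h2, h3, fun hw' => ?_, fun hw' => ?_⟩
  · simp only [hup w hw hw', cauchyLogV]
  · simp only
    rw [hlo w hw hw', neg_sub, sub_eq_add_neg, exp_add, exp_log (slitPlane_ne_zero h4), mul_comm]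
    rfl

end

/-! ### The elementary prefactors of `Q⁺` and `Q⁻` -/

/-- The factor of `Q⁺` that does not involve `v_↑`. -/
def prefPlus (hbar g κ : ℝ) {N : ℕ} (δ : Fin N → ℂ) (z : ℂ) : ℂ :=
  ((κ * g ^ N : ℝ) : ℂ) ^ (-I * z) * (hbar : ℂ) ^ (I * N * z / hbar) *
    exp (-(N * Real.pi * z / hbar)) / ∏ k, Gamma (1 - I * (z - δ k) / hbar)

/-- The factor of `Q⁻` that does not involve `v_↓`. -/
def prefMinus (hbar g : ℝ) {N : ℕ} (δ : Fin N → ℂ) (z : ℂ) : ℂ :=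
  (g : ℂ) ^ (I * N * z) * (hbar : ℂ) ^ (-(I * N * z / hbar)) *
    exp (-(N * Real.pi * z / hbar)) / ∏ k, Gamma (1 + I * (z - δ k) / hbar)

theorem ofReal_cpow_eq_exp {x : ℝ} (hx : 0 < x) (s : ℂ) :
    (x : ℂ) ^ s = exp ((Real.log x : ℝ) * s) := by
  rw [cpow_def_of_ne_zero (ofReal_ne_zero.2 hx.ne'), ofReal_log hx.le]

section

variable {hbar g κ : ℝ} {N : ℕ} {δ : Fin N → ℂ}

/-- At its poles `Gamma` takes the value `0`, whose inverse `0` is the value of the entire function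
`1 / Γ`, so no exceptional points arise. -/
theorem differentiable_prod_Gamma_inv (s : Fin N → ℂ → ℂ) (hs : ∀ k, Differentiable ℂ (s k)) :
    Differentiable ℂ fun z => (∏ k, Gamma (s k z))⁻¹ := by
  simp_rw [← Finset.prod_inv_distrib]
  exact Differentiable.fun_finsetProd fun k _ => differentiable_one_div_Gamma.comp (hs k)

theorem differentiable_prefPlus (hh : 0 < hbar) (hg : 0 < g) (hκ : 0 < κ) :
    Differentiable ℂ (prefPlus hbar g κ δ) := by
  have ha : 0 < κ * g ^ N := by positivity
  unfold prefPlus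
  simp_rw [ofReal_cpow_eq_exp ha, ofReal_cpow_eq_exp hh, div_eq_mul_inv _ (∏ k, Gamma _)]
  refine Differentiable.mul (by fun_prop) (differentiable_prod_Gamma_inv _ fun k => ?_)
  fun_prop

theorem prod_const_mul_sub (c : ℂ) (z : ℂ) :
    ∏ k, (c * (z - δ k)) = c ^ N * monic δ z := by
  rw [Finset.prod_mul_distrib]
  simp [monic]

theorem exp_neg_nat_pi_I (N : ℕ) : exp (-(N * Real.pi * I)) = (-1) ^ N := by
  rw [show -((N : ℂ) * Real.pi * I) = N * (-(Real.pi * I)) by ring, exp_nat_mul, exp_neg, exp_pi_mul_I]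
  norm_num

theorem hbar_cpow : (hbar : ℂ) ^ (-(N : ℂ)) = ((hbar : ℂ) ^ N)⁻¹ := by
  rw [cpow_neg, cpow_natCast]

theorem neg_I_pow_mul_self (N : ℕ) : (-I) ^ N * (-I) ^ N = (-1) ^ N := by
  rw [← mul_pow]
  simp

/-- The powers and the exponential contribute constants, and `Γ(s + 1) = s Γ(s)` contributes `ϑ`.
Keeping `ϑ(z + iℏ)` on the left makes the relation valid at its zeros too. -/
theorem prefPlus_add (hh : 0 < hbar) (hg : 0 < g) (hκ : 0 < κ) (z : ℂ) :
    monic δ (z + I * hbar) * prefPlus hbar g κ δ (z + I * hbar) =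
      (-I) ^ N * (((κ * g ^ N) ^ hbar : ℝ) : ℂ) * prefPlus hbar g κ δ z := by
  have ha : 0 < κ * g ^ N := by positivity
  have hhc : (hbar : ℂ) ≠ 0 := ofReal_ne_zero.2 hh.ne'
  have hac : ((κ * g ^ N : ℝ) : ℂ) ≠ 0 := ofReal_ne_zero.2 ha.ne'
  have e1 : ((κ * g ^ N : ℝ) : ℂ) ^ (-I * (z + I * hbar)) =
      ((κ * g ^ N : ℝ) : ℂ) ^ (-I * z) * (((κ * g ^ N) ^ hbar : ℝ) : ℂ) := by
    rw [ofReal_cpow ha.le, ← cpow_add _ _ hac]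
    congr 1
    linear_combination (-(hbar : ℂ)) * I_sq
  have e2 : (hbar : ℂ) ^ (I * N * (z + I * hbar) / hbar) =
      (hbar : ℂ) ^ (I * N * z / hbar) * ((hbar : ℂ) ^ N)⁻¹ := by
    rw [← hbar_cpow, ← cpow_add _ _ hhc]
    congr 1
    field_simp
    linear_combination (N * (hbar : ℂ)) * I_sq
  have e3 : exp (-(N * Real.pi * (z + I * hbar) / hbar)) =
      exp (-(N * Real.pi * z / hbar)) * (-1) ^ N := by
    rw [← exp_neg_nat_pi_I, ← exp_add]
    congr 1
    field_simp
    ring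
  have e4 : (∏ k, Gamma (1 - I * (z - δ k) / hbar))⁻¹ =
      (-I / hbar) ^ N * monic δ (z + I * hbar) *
        (∏ k, Gamma (1 - I * (z + I * hbar - δ k) / hbar))⁻¹ := by
    rw [← prod_const_mul_sub, ← Finset.prod_inv_distrib, ← Finset.prod_inv_distrib,
      ← Finset.prod_mul_distrib]
    refine Finset.prod_congr rfl fun k _ => ?_
    rw [one_div_Gamma_eq_self_mul_one_div_Gamma_add_one]
    have h1 : 1 - I * (z - δ k) / hbar = -I / hbar * (z + I * hbar - δ k) := by
      field_simp
      linear_combination (hbar : ℂ) * I_sq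
    have h2 : 1 - I * (z - δ k) / hbar + 1 = 1 - I * (z + I * hbar - δ k) / hbar := by
      field_simp
      linear_combination (hbar : ℂ) * I_sq
    rw [h2, h1]
  simp only [prefPlus, div_eq_mul_inv _ (∏ k, Gamma _)]
  rw [e1, e2, e3, e4, div_pow, ← neg_I_pow_mul_self]
  ring

theorem prefMinus_add (hh : 0 < hbar) (hg : 0 < g) (z : ℂ) :
    prefMinus hbar g δ (z + I * hbar) =
      (-I) ^ N * ((g ^ hbar : ℝ) : ℂ)⁻¹ ^ N * monic δ z * prefMinus hbar g δ z := by
  have hhc : (hbar : ℂ) ≠ 0 := ofReal_ne_zero.2 hh.ne'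
  have hgc : (g : ℂ) ≠ 0 := ofReal_ne_zero.2 hg.ne'
  have e1 : (g : ℂ) ^ (I * N * (z + I * hbar)) =
      (g : ℂ) ^ (I * N * z) * ((g ^ hbar : ℝ) : ℂ)⁻¹ ^ N := by
    rw [ofReal_cpow hg.le, ← cpow_neg, ← cpow_nat_mul, ← cpow_add _ _ hgc]
    congr 1
    linear_combination (N * (hbar : ℂ)) * I_sq
  have e2 : (hbar : ℂ) ^ (-(I * N * (z + I * hbar) / hbar)) =
      (hbar : ℂ) ^ (-(I * N * z / hbar)) * (hbar : ℂ) ^ N := by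
    rw [← cpow_natCast, ← cpow_add _ _ hhc]
    congr 1
    field_simp
    linear_combination (-(N * (hbar : ℂ))) * I_sq
  have e3 : exp (-(N * Real.pi * (z + I * hbar) / hbar)) =
      exp (-(N * Real.pi * z / hbar)) * (-1) ^ N := by
    rw [← exp_neg_nat_pi_I, ← exp_add]
    congr 1
    field_simp
    ring
  have e4 : (∏ k, Gamma (1 + I * (z + I * hbar - δ k) / hbar))⁻¹ =
      (I / hbar) ^ N * monic δ z * (∏ k, Gamma (1 + I * (z - δ k) / hbar))⁻¹ := by
    rw [← prod_const_mul_sub, ← Finset.prod_inv_distrib, ← Finset.prod_inv_distrib,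
      ← Finset.prod_mul_distrib]
    refine Finset.prod_congr rfl fun k _ => ?_
    rw [one_div_Gamma_eq_self_mul_one_div_Gamma_add_one]
    have h1 : 1 + I * (z + I * hbar - δ k) / hbar = I / hbar * (z - δ k) := by
      field_simp
      linear_combination (hbar : ℂ) * I_sq
    have h2 : I / hbar * (z - δ k) + 1 = 1 + I * (z - δ k) / hbar := by
      field_simp
      ring
    rw [h1, h2]
  have e5 : (-1 : ℂ) ^ N * I ^ N = (-I) ^ N := by
    rw [← mul_pow]
    simp
  simp only [prefMinus, div_eq_mul_inv _ (∏ k, Gamma _)]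
  rw [e1, e2, e3, e4, div_pow, ← e5]
  field_simp

theorem prefMinus_eq_conj (hh : 0 < hbar) (hg : 0 < g) (hκ : 0 < κ) (hδ : SelfConj δ) (z : ℂ) :
    prefMinus hbar g δ z = (κ : ℂ) ^ (-I * z) *
      (starRingEnd ℂ) (prefPlus hbar g κ δ ((starRingEnd ℂ) z)) := by
  have ha : 0 < κ * g ^ N := by positivity
  obtain ⟨σ, hσ⟩ := hδ
  have e : (starRingEnd ℂ) (∏ k, Gamma (1 - I * ((starRingEnd ℂ) z - δ k) / hbar)) =
      ∏ k, Gamma (1 + I * (z - δ k) / hbar) := by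
    rw [map_prod, ← Equiv.prod_comp σ fun k => Gamma (1 + I * (z - δ k) / hbar)]
    refine Finset.prod_congr rfl fun k _ => ?_
    rw [← Gamma_conj, ← hσ]
    congr 1
    simp only [map_sub, map_one, map_div₀, map_mul, conj_I, conj_conj, conj_ofReal]
    ring
  have hlog : Real.log (κ * g ^ N) = Real.log κ + N * Real.log g := by
    rw [Real.log_mul hκ.ne' (by positivity), Real.log_pow]
  rw [prefMinus, prefPlus, map_div₀, e]
  simp only [ofReal_cpow_eq_exp ha, ofReal_cpow_eq_exp hh, ofReal_cpow_eq_exp hg,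
    ofReal_cpow_eq_exp hκ, map_mul, ← exp_conj, mul_div_assoc']
  congr 1
  simp only [← exp_add]
  congr 1
  simp only [map_neg, map_div₀, map_mul, conj_I, conj_conj, conj_ofReal, map_natCast]
  rw [hlog]
  push_cast
  ring

theorem vDownShift_eq_conj {ρ : ℝ} {Y : ℝ → ℝ} (z : ℂ) :
    vDownShift hbar ρ δ Y z = (starRingEnd ℂ) (vUp hbar ρ δ Y ((starRingEnd ℂ) z)) := by
  rw [vDownShift, vUp, ← exp_conj, map_neg, ← integral_conj, ← integral_neg]
  congr 1
  refine integral_congr_ae (Eventually.of_forall fun μ => ?_)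
  simp only [map_mul, map_div₀, map_one, map_add, map_sub, conj_I, conj_conj, conj_ofReal,
    map_ofNat]
  rw [show z - μ + -I * hbar / 2 = z - μ - I * hbar / 2 by ring, mul_neg, div_neg, neg_mul, neg_mul,
    neg_neg]

end

/-! ### The entire functions `Q⁺` and `Q⁻` -/

section

variable {hbar g κ : ℝ} {N : ℕ} {δ : Fin N → ℂ} {Y : ℝ → ℝ}

theorem exists_entire_QPlus (hh : 0 < hbar) (hg : 0 < g) (hκ : 0 < κ) (hN : N ≠ 0)
    (hδ : SelfConj δ) (him : ∀ k, |(δ k).im| < hbar / 2)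
    (hY : IsNLIESolution hbar (κ * g ^ (2 * N)) δ Y) :
    ∃ F : ℂ → ℂ, Differentiable ℂ F ∧
      (∀ z : ℂ, -(hbar / 2) < z.im →
        F z = prefPlus hbar g κ δ z * vUp hbar (κ * g ^ (2 * N)) δ Y z) ∧
      ∀ z : ℂ, z.im < -(hbar / 2) →
        F z = exp (-cauchyLogV hbar (κ * g ^ (2 * N)) δ Y (z + I * hbar / 2)) *
          (prefPlus hbar g κ δ z + (((κ * g ^ (2 * N)) ^ hbar : ℝ) : ℂ) /
            ((-I) ^ N * (((κ * g ^ N) ^ hbar : ℝ) : ℂ)) * F (z + I * hbar) *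
            exp (cauchyLogV hbar (κ * g ^ (2 * N)) δ Y (z - I * hbar / 2)) / monic δ z) := by
  set ρ := κ * g ^ (2 * N) with hρdef
  have hρ : 0 < ρ := by positivity
  have ha : (0 : ℝ) < κ * g ^ N := by positivity
  have hac : ((((κ * g ^ N) ^ hbar : ℝ) : ℂ)) ≠ 0 := ofReal_ne_zero.2 (by positivity)
  have hI : ((-I) ^ N : ℂ) ≠ 0 := pow_ne_zero _ (neg_ne_zero.2 I_ne_zero)
  set T := cauchyLogV hbar ρ δ Y with hT
  have hTd : ∀ {u : ℂ}, u.im ≠ 0 → DifferentiableAt ℂ T u := fun hu =>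
    differentiableAt_cauchyLogV hN hρ him hY hu
  have hp : Differentiable ℂ (prefPlus hbar g κ δ) := differentiable_prefPlus hh hg hκ
  have hup : ∀ z : ℂ, z.im ≠ -(hbar / 2) → DifferentiableAt ℂ (fun z => T (z + I * hbar / 2)) z := by
    intro z hz
    refine (hTd ?_).comp z (by fun_prop)
    simp only [add_im, div_ofNat_im, mul_im, I_re, I_im, ofReal_re, ofReal_im]
    intro h
    exact hz (by linarith)
  have hdn : ∀ z : ℂ, z.im < hbar / 2 → DifferentiableAt ℂ (fun z => T (z - I * hbar / 2)) z := by
    intro z hz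
    refine (hTd ?_).comp z (by fun_prop)
    simp only [sub_im, div_ofNat_im, mul_im, I_re, I_im, ofReal_re, ofReal_im]
    linarith
  -- Multiplying `exp (-T) V` by the prefactor: by `prefPlus_add`, the second term of `V`
  -- reassembles `f(z + iℏ)`. Hence the continuation has the form `A z + B z * f (z + iℏ)`, with `A`
  -- and `B` holomorphic below the line because `ϑ` has no zeros there.
  let f : ℂ → ℂ := fun z => prefPlus hbar g κ δ z * exp (-T (z + I * hbar / 2))
  let A : ℂ → ℂ := fun z => exp (-T (z + I * hbar / 2)) * prefPlus hbar g κ δ z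
  let B : ℂ → ℂ := fun z => exp (-T (z + I * hbar / 2)) *
    ((((ρ ^ hbar : ℝ) : ℂ) / ((-I) ^ N * (((κ * g ^ N) ^ hbar : ℝ) : ℂ))) *
      exp (T (z - I * hbar / 2)) / monic δ z)
  have hmne : ∀ z : ℂ, z.im < -(hbar / 2) → monic δ z ≠ 0 := by
    intro z hz
    rw [monic_ne_zero_iff]
    intro k hk
    have := (abs_lt.1 (him k)).1
    rw [← hk] at this
    linarith
  have hf : DifferentiableOn ℂ f {z | -(hbar / 2) < z.im} := by
    intro z hz
    exact ((hp z).mul (hup z (ne_of_gt hz)).neg.cexp).differentiableWithinAt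
  have hA : DifferentiableOn ℂ A {z | z.im < -(hbar / 2)} := by
    intro z hz
    exact ((hup z (ne_of_lt hz)).neg.cexp.mul (hp z)).differentiableWithinAt
  have hB : DifferentiableOn ℂ B {z | z.im < -(hbar / 2)} := by
    intro z hz
    have hz' : z.im < hbar / 2 := lt_trans hz (by linarith)
    exact ((hup z (ne_of_lt hz)).neg.cexp.mul (((hdn z hz').cexp.const_mul _).div
      (differentiable_monic δ z) (hmne z hz))).differentiableWithinAt
  have hloc : ∀ z₀ : ℂ, z₀.im = -(hbar / 2) → ∃ r > 0, ∃ h : ℂ → ℂ,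
      DifferentiableOn ℂ h (Metric.ball z₀ r) ∧
      (∀ z ∈ Metric.ball z₀ r, -(hbar / 2) < z.im → h z = f z) ∧
      ∀ z ∈ Metric.ball z₀ r, z.im < -(hbar / 2) → h z = A z + B z * f (z + I * hbar) := by
    intro z₀ hz₀
    obtain ⟨R, hR, h, hd, hb⟩ :=
      exists_local_extension_exp_cauchyLogV hh hN hρ hδ him hY z₀.re
    have hw₀ : z₀ + I * hbar / 2 = z₀.re := by
      apply Complex.ext <;> simp [hz₀]
    have hball : ∀ z ∈ Metric.ball z₀ R, z + I * hbar / 2 ∈ Metric.ball (z₀.re : ℂ) R := by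
      intro z hz
      rw [← hw₀, Metric.mem_ball, dist_add_right]
      exact hz
    have him' : ∀ z : ℂ, (z + I * hbar / 2).im = z.im + hbar / 2 := by
      intro z
      simp
    refine ⟨R, hR, fun z => prefPlus hbar g κ δ z * h (z + I * hbar / 2), ?_, ?_, ?_⟩
    · exact hp.differentiableOn.mul (hd.comp (by fun_prop) hball)
    · intro z hz hzim
      simp only [f]
      rw [(hb _ (hball z hz)).2.2.1 (by rw [him']; linarith)]
    · intro z hz hzim
      obtain ⟨h1, h2, -, h4⟩ := hb _ (hball z hz)
      simp only [f, A, B]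
      rw [h4 (by rw [him']; linarith), VExt]
      rw [show z + I * hbar / 2 - I * hbar / 2 = z by ring] at h1 ⊢
      rw [show z + I * hbar / 2 + I * hbar / 2 = z + I * hbar by ring] at h2 ⊢
      rw [show z + I * hbar / 2 - I * hbar = z - I * hbar / 2 by ring,
        show z + I * hbar / 2 + I * hbar = z + I * hbar + I * hbar / 2 by ring, sub_eq_add_neg,
        exp_add]
      have hs : prefPlus hbar g κ δ (z + I * hbar) =
          (-I) ^ N * (((κ * g ^ N) ^ hbar : ℝ) : ℂ) * prefPlus hbar g κ δ z /
            monic δ (z + I * hbar) := by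
        rw [eq_div_iff h2, mul_comm, prefPlus_add hh hg hκ]
      rw [hs]
      field_simp
      rfl
  obtain ⟨F, hF, hF1, hF2⟩ := exists_entire_solution_of_step hh hf hA hB hloc
  refine ⟨F, hF, fun z hz => ?_, fun z hz => ?_⟩
  · rw [hF1 hz, vUp_eq]
  · rw [hF2 z hz]
    simp only [A, B]
    ring

/-- `Q⁻(z)` is `κ^(-iz)` times the conjugate of `Q⁺` at the conjugate point, so no second
continuation is needed. -/
theorem exists_entire_QMinus (hh : 0 < hbar) (hg : 0 < g) (hκ : 0 < κ) (hN : N ≠ 0)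
    (hδ : SelfConj δ) (him : ∀ k, |(δ k).im| < hbar / 2)
    (hY : IsNLIESolution hbar (κ * g ^ (2 * N)) δ Y) :
    ∃ F : ℂ → ℂ, Differentiable ℂ F ∧ ∀ z : ℂ, z.im < hbar / 2 →
        F z = prefMinus hbar g δ z * vDownShift hbar (κ * g ^ (2 * N)) δ Y z := by
  obtain ⟨F, hF, hF1, -⟩ := exists_entire_QPlus hh hg hκ hN hδ him hY
  refine ⟨fun z => (κ : ℂ) ^ (-I * z) * (starRingEnd ℂ) (F ((starRingEnd ℂ) z)), ?_, ?_⟩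
  · simp_rw [ofReal_cpow_eq_exp hκ]
    refine Differentiable.mul (by fun_prop) fun z => ?_
    have := (hF ((starRingEnd ℂ) z)).conj_conj
    rwa [conj_conj] at this
  · intro z hz
    simp only
    rw [hF1 _ (by rw [conj_im]; linarith), prefMinus_eq_conj hh hg hκ hδ, vDownShift_eq_conj,
      map_mul, mul_assoc]

theorem entireContinuation_spec {U : Set ℂ} {f F : ℂ → ℂ} (hF : Differentiable ℂ F)
    (h : Set.EqOn F f U) :
    Differentiable ℂ (entireContinuation U f) ∧ Set.EqOn (entireContinuation U f) f U := by
  have hex : ∃ F : ℂ → ℂ, Differentiable ℂ F ∧ Set.EqOn F f U := ⟨F, hF, h⟩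
  rw [entireContinuation, dif_pos hex]
  exact hex.choose_spec

theorem eq_of_eqOn_open {F G : ℂ → ℂ} (hF : Differentiable ℂ F) (hG : Differentiable ℂ G)
    {U : Set ℂ} (hU : IsOpen U) (hne : U.Nonempty) (h : Set.EqOn F G U) : F = G := by
  obtain ⟨z₀, hz₀⟩ := hne
  have hF' : AnalyticOnNhd ℂ F Set.univ := fun z _ => hF.analyticAt z
  have hG' : AnalyticOnNhd ℂ G Set.univ := fun z _ => hG.analyticAt z
  exact hF'.eq_of_eventuallyEq hG' (h.eventuallyEq_of_mem (hU.mem_nhds hz₀))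

/-- By the identity theorem the continuation picked by `entireContinuation` is the one constructed
above, and so obeys its difference equation. -/
theorem QPlus_spec (hh : 0 < hbar) (hg : 0 < g) (hκ : 0 < κ) (hN : N ≠ 0)
    (hδ : SelfConj δ) (him : ∀ k, |(δ k).im| < hbar / 2)
    (hY : IsNLIESolution hbar (κ * g ^ (2 * N)) δ Y) :
    Differentiable ℂ (QPlus hbar g κ δ Y) ∧
      (∀ z : ℂ, -(hbar / 2) < z.im →
        QPlus hbar g κ δ Y z = prefPlus hbar g κ δ z * vUp hbar (κ * g ^ (2 * N)) δ Y z) ∧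
      ∀ z : ℂ, z.im < -(hbar / 2) →
        QPlus hbar g κ δ Y z =
          exp (-cauchyLogV hbar (κ * g ^ (2 * N)) δ Y (z + I * hbar / 2)) *
          (prefPlus hbar g κ δ z + (((κ * g ^ (2 * N)) ^ hbar : ℝ) : ℂ) /
            ((-I) ^ N * (((κ * g ^ N) ^ hbar : ℝ) : ℂ)) * QPlus hbar g κ δ Y (z + I * hbar) *
            exp (cauchyLogV hbar (κ * g ^ (2 * N)) δ Y (z - I * hbar / 2)) / monic δ z) := by
  obtain ⟨F, hF, hF1, hF2⟩ := exists_entire_QPlus hh hg hκ hN hδ him hY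
  have key : ∀ z : ℂ, -(hbar / 2) < z.im → F z = ((κ * g ^ N : ℝ) : ℂ) ^ (-I * z) *
      (hbar : ℂ) ^ (I * N * z / hbar) * exp (-(N * Real.pi * z / hbar)) *
      vUp hbar (κ * g ^ (2 * N)) δ Y z / ∏ k, Gamma (1 - I * (z - δ k) / hbar) := by
    intro z hz
    rw [hF1 z hz, prefPlus, div_mul_eq_mul_div]
  obtain ⟨h1, h2⟩ := entireContinuation_spec (U := {z : ℂ | -(hbar / 2) < z.im}) hF key
  have hQ : QPlus hbar g κ δ Y = F :=
    eq_of_eqOn_open h1 hF (isOpen_lt_im _) ⟨0, by simp [hh]⟩ fun z hz =>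
      (h2 hz).trans (key z hz).symm
  rw [hQ]
  exact ⟨hF, hF1, hF2⟩

theorem QMinus_spec (hh : 0 < hbar) (hg : 0 < g) (hκ : 0 < κ) (hN : N ≠ 0)
    (hδ : SelfConj δ) (him : ∀ k, |(δ k).im| < hbar / 2)
    (hY : IsNLIESolution hbar (κ * g ^ (2 * N)) δ Y) :
    Differentiable ℂ (QMinus hbar g κ δ Y) ∧ ∀ z : ℂ, z.im < hbar / 2 →
        QMinus hbar g κ δ Y z =
          prefMinus hbar g δ z * vDownShift hbar (κ * g ^ (2 * N)) δ Y z := by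
  obtain ⟨F, hF, hF1⟩ := exists_entire_QMinus hh hg hκ hN hδ him hY
  have key : ∀ z : ℂ, z.im < hbar / 2 → F z = (g : ℂ) ^ (I * N * z) *
      (hbar : ℂ) ^ (-(I * N * z / hbar)) * exp (-(N * Real.pi * z / hbar)) *
      vDownShift hbar (κ * g ^ (2 * N)) δ Y z / ∏ k, Gamma (1 + I * (z - δ k) / hbar) := by
    intro z hz
    rw [hF1 z hz, prefMinus, div_mul_eq_mul_div]
  obtain ⟨h1, h2⟩ := entireContinuation_spec (U := {z : ℂ | z.im < hbar / 2}) hF key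
  have hQ : QMinus hbar g κ δ Y = F :=
    eq_of_eqOn_open h1 hF (isOpen_im_lt _) ⟨0, by simp [hh]⟩ fun z hz =>
      (h2 hz).trans (key z hz).symm
  rw [hQ]
  exact ⟨hF, hF1⟩

end

/-! ### The quantum Wronskian and the Baxter polynomial -/

section

variable {hbar g κ : ℝ} {N : ℕ} {δ τ : Fin N → ℂ} {Y : ℝ → ℝ}

theorem rpow_mul_rpow_pow (hg : 0 < g) (hκ : 0 < κ) :
    (κ * g ^ N) ^ hbar * (g ^ hbar) ^ N = (κ * g ^ (2 * N)) ^ hbar := by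
  have : (g ^ hbar) ^ N = (g ^ N) ^ hbar := by
    rw [← Real.rpow_natCast, ← Real.rpow_mul hg.le, mul_comm, Real.rpow_mul hg.le,
      Real.rpow_natCast]
  rw [this, ← Real.mul_rpow (by positivity) (by positivity)]
  congr 1
  ring

theorem wronskian_eq (hh : 0 < hbar) (hg : 0 < g) (hκ : 0 < κ) (hN : N ≠ 0)
    (hδ : SelfConj δ) (him : ∀ k, |(δ k).im| < hbar / 2)
    (hY : IsNLIESolution hbar (κ * g ^ (2 * N)) δ Y) (z : ℂ) :
    wronskian hbar g κ δ Y z = (-I) ^ N * ((g ^ hbar : ℝ) : ℂ)⁻¹ ^ N * monic δ z *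
      prefPlus hbar g κ δ z * prefMinus hbar g δ z := by
  obtain ⟨hP, -, hP2⟩ := QPlus_spec hh hg hκ hN hδ him hY
  obtain ⟨hM, hM1⟩ := QMinus_spec hh hg hκ hN hδ him hY
  have hp := differentiable_prefPlus (δ := δ) hh hg hκ
  have hm : Differentiable ℂ (prefMinus hbar g δ) := by
    unfold prefMinus
    simp_rw [ofReal_cpow_eq_exp hg, ofReal_cpow_eq_exp hh, div_eq_mul_inv _ (∏ k, Gamma _)]
    refine Differentiable.mul (by fun_prop) (differentiable_prod_Gamma_inv _ fun k => ?_)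
    fun_prop
  have hmon := differentiable_monic δ
  have hPs : Differentiable ℂ fun z => QPlus hbar g κ δ Y (z + I * hbar) :=
    hP.comp (by fun_prop)
  have hMs : Differentiable ℂ fun z => QMinus hbar g κ δ Y (z + I * hbar) :=
    hM.comp (by fun_prop)
  refine congrFun (eq_of_eqOn_open (F := wronskian hbar g κ δ Y)
    (G := fun z => (-I) ^ N * ((g ^ hbar : ℝ) : ℂ)⁻¹ ^ N * monic δ z *
      prefPlus hbar g κ δ z * prefMinus hbar g δ z)
    ((hP.mul hMs).sub (hPs.mul hM)) (((hmon.const_mul _).mul hp).mul hm)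
    (isOpen_im_lt (-(hbar / 2))) ⟨-I * hbar, by simp [hh]⟩ fun z hz => ?_) z
  have hz : z.im < -(hbar / 2) := hz
  have hz1 : (z + I * hbar).im < hbar / 2 := by
    rw [add_I_mul_im]
    linarith
  have hmne : monic δ z ≠ 0 := by
    rw [monic_ne_zero_iff]
    intro k hk
    have := (abs_lt.1 (him k)).1
    rw [← hk] at this
    linarith
  have hI : ((-I) ^ N : ℂ) ≠ 0 := pow_ne_zero _ (neg_ne_zero.2 I_ne_zero)
  have hac : ((((κ * g ^ N) ^ hbar : ℝ) : ℂ)) ≠ 0 := ofReal_ne_zero.2 (by positivity)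
  have hgc : ((g ^ hbar : ℝ) : ℂ) ≠ 0 := ofReal_ne_zero.2 (by positivity)
  -- Below the line, the factor `exp (-T(z + iℏ/2))` of `Q⁺(z)` cancels against `v_↓` in `Q⁻(z +
  -- iℏ)`. The second term of the difference equation then becomes `Q⁺(z + iℏ) Q⁻(z)`, and the first
  -- is the claimed value. The identity theorem extends this to all `z`.
  simp only [wronskian]
  rw [hP2 z hz, hM1 z (by linarith), hM1 _ hz1, vDownShift_eq, vDownShift_eq,
    prefMinus_add hh hg, show z + I * hbar - I * hbar / 2 = z + I * hbar / 2 by ring,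
    ← rpow_mul_rpow_pow hg hκ, exp_neg, inv_pow]
  push_cast
  have := exp_ne_zero (cauchyLogV hbar (κ * g ^ (2 * N)) δ Y (z + I * hbar / 2))
  field_simp
  ring

theorem prefPlus_ne_zero (hh : 0 < hbar) (hg : 0 < g) (hκ : 0 < κ)
    (him : ∀ k, |(δ k).im| < hbar / 2) (x : ℝ) : prefPlus hbar g κ δ x ≠ 0 := by
  have ha : 0 < κ * g ^ N := by positivity
  rw [prefPlus, ofReal_cpow_eq_exp ha, ofReal_cpow_eq_exp hh]
  refine div_ne_zero (mul_ne_zero (mul_ne_zero (exp_ne_zero _) (exp_ne_zero _)) (exp_ne_zero _))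
    (Finset.prod_ne_zero_iff.2 fun k _ => Gamma_ne_zero_of_re_pos ?_)
  have h := (abs_lt.1 (him k)).2
  simp only [sub_re, one_re, div_ofReal_re, mul_re, I_re, I_im, sub_im, ofReal_im]
  have : (δ k).im / hbar < 1 := by
    rw [div_lt_one hh]
    linarith
  have e : (0 * ((x : ℂ).re - (δ k).re) - 1 * (0 - (δ k).im)) / hbar = (δ k).im / hbar := by ring
  rw [e]
  linarith

theorem prefMinus_ne_zero (hh : 0 < hbar) (hg : 0 < g)
    (him : ∀ k, |(δ k).im| < hbar / 2) (x : ℝ) : prefMinus hbar g δ x ≠ 0 := by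
  rw [prefMinus, ofReal_cpow_eq_exp hg, ofReal_cpow_eq_exp hh]
  refine div_ne_zero (mul_ne_zero (mul_ne_zero (exp_ne_zero _) (exp_ne_zero _)) (exp_ne_zero _))
    (Finset.prod_ne_zero_iff.2 fun k _ => Gamma_ne_zero_of_re_pos ?_)
  have h := (abs_lt.1 (him k)).1
  simp only [add_re, one_re, div_ofReal_re, mul_re, I_re, I_im, sub_im, ofReal_im, sub_re]
  have : -1 < (δ k).im / hbar := by
    rw [lt_div_iff₀ hh]
    linarith
  have e : (0 * ((x : ℂ).re - (δ k).re) - 1 * (0 - (δ k).im)) / hbar = (δ k).im / hbar := by ring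
  rw [e]
  linarith

/-- The Baxter polynomial on the real axis, in terms of `v_↑` and `v_↓`. -/
theorem monic_mul_vUp_mul_vDownShift (hh : 0 < hbar) (hg : 0 < g) (hκ : 0 < κ) (hN : N ≠ 0)
    (hδ : SelfConj δ) (him : ∀ k, |(δ k).im| < hbar / 2)
    (hY : IsNLIESolution hbar (κ * g ^ (2 * N)) δ Y) (ht : IsZerosOfTDelta hbar g κ δ τ Y)
    {x : ℝ} (hx : monic δ x ≠ 0) :
    monic τ x * (vUp hbar (κ * g ^ (2 * N)) δ Y x * vDownShift hbar (κ * g ^ (2 * N)) δ Y x) =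
      monic δ x + (((κ * g ^ (2 * N)) ^ hbar : ℝ) : ℂ) *
        (vUp hbar (κ * g ^ (2 * N)) δ Y (x + I * hbar) *
            vDownShift hbar (κ * g ^ (2 * N)) δ Y x / monic δ (x + I * hbar) +
          vUp hbar (κ * g ^ (2 * N)) δ Y x *
            vDownShift hbar (κ * g ^ (2 * N)) δ Y (x - I * hbar) / monic δ (x - I * hbar)) := by
  obtain ⟨-, hP1, -⟩ := QPlus_spec hh hg hκ hN hδ him hY
  obtain ⟨-, hM1⟩ := QMinus_spec hh hg hκ hN hδ him hY
  have hp0 := prefPlus_ne_zero hh hg hκ him x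
  have hm0 := prefMinus_ne_zero hh hg him x
  have hI : ((-I) ^ N : ℂ) ≠ 0 := pow_ne_zero _ (neg_ne_zero.2 I_ne_zero)
  have hac : ((((κ * g ^ N) ^ hbar : ℝ) : ℂ)) ≠ 0 := ofReal_ne_zero.2 (by positivity)
  have hgc : ((g ^ hbar : ℝ) : ℂ)⁻¹ ^ N ≠ 0 :=
    pow_ne_zero _ (inv_ne_zero (ofReal_ne_zero.2 (by positivity)))
  have hW := wronskian_eq hh hg hκ hN hδ him hY
  have hW0 : wronskian hbar g κ δ Y x ≠ 0 := by
    rw [hW]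
    exact mul_ne_zero (mul_ne_zero (mul_ne_zero (mul_ne_zero hI hgc) hx) hp0) hm0
  have hup : monic δ ((x : ℂ) + I * hbar) ≠ 0 := by
    rw [monic_ne_zero_iff]
    intro k hk
    have := (abs_lt.1 (him k)).2
    rw [← hk] at this
    simp at this
    linarith
  have hdn : monic δ ((x : ℂ) - I * hbar) ≠ 0 := by
    rw [monic_ne_zero_iff]
    intro k hk
    have := (abs_lt.1 (him k)).1
    rw [← hk] at this
    simp at this
    linarith
  have hback : (x : ℂ) - I * hbar + I * hbar = x := by ring
  have htx := ht x hW0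
  have hWm := hW (x - I * hbar)
  have hWx := hW x
  have hsP := prefPlus_add (δ := δ) hh hg hκ (x - I * hbar)
  have hsP' := prefPlus_add (δ := δ) hh hg hκ x
  have hsM := prefMinus_add (δ := δ) hh hg (x - I * hbar)
  rw [hback] at hsP hsM
  have hρ : (((κ * g ^ (2 * N)) ^ hbar : ℝ) : ℂ) * ((g ^ hbar : ℝ) : ℂ)⁻¹ ^ N =
      (((κ * g ^ N) ^ hbar : ℝ) : ℂ) := by
    have h0 : ((g ^ hbar : ℝ) : ℂ) ≠ 0 := ofReal_ne_zero.2 (by positivity)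
    rw [← rpow_mul_rpow_pow hg hκ, ofReal_mul, ofReal_pow, mul_assoc, ← mul_pow,
      mul_inv_cancel₀ h0, one_pow, mul_one]
  have hPx := hP1 x (by simp [hh])
  have hPu := hP1 (x + I * hbar) (by rw [add_I_mul_im]; simp; linarith)
  have hMx := hM1 x (by simp [hh])
  have hMd := hM1 (x - I * hbar) (by simp; linarith)
  rw [tDelta, div_eq_iff hW0] at htx
  rw [wronskian] at hWm hWx htx
  rw [hback] at hWm
  generalize QPlus hbar g κ δ Y x = P at *
  generalize QPlus hbar g κ δ Y (x + I * hbar) = P₁ at *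
  generalize QPlus hbar g κ δ Y (x - I * hbar) = P₂ at *
  generalize QMinus hbar g κ δ Y x = M at *
  generalize QMinus hbar g κ δ Y (x + I * hbar) = M₁ at *
  generalize QMinus hbar g κ δ Y (x - I * hbar) = M₂ at *
  generalize vUp hbar (κ * g ^ (2 * N)) δ Y x = u at *
  generalize vUp hbar (κ * g ^ (2 * N)) δ Y (x + I * hbar) = u₁ at *
  generalize vDownShift hbar (κ * g ^ (2 * N)) δ Y x = d at *
  generalize vDownShift hbar (κ * g ^ (2 * N)) δ Y (x - I * hbar) = d₂ at *
  generalize prefPlus hbar g κ δ x = p at *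
  generalize prefPlus hbar g κ δ (x + I * hbar) = p₁ at *
  generalize prefPlus hbar g κ δ (x - I * hbar) = p₂ at *
  generalize prefMinus hbar g δ x = m at *
  generalize prefMinus hbar g δ (x - I * hbar) = m₂ at *
  generalize (((κ * g ^ (2 * N)) ^ hbar : ℝ) : ℂ) = ρ at *
  generalize (((κ * g ^ N) ^ hbar : ℝ) : ℂ) = a at *
  generalize ((g ^ hbar : ℝ) : ℂ)⁻¹ ^ N = γ at *
  generalize monic δ (x : ℂ) = t₀ at *
  generalize monic δ ((x : ℂ) + I * hbar) = t₁ at *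
  generalize monic δ ((x : ℂ) - I * hbar) = t₂ at *
  generalize monic τ (x : ℂ) = t at *
  generalize (-I : ℂ) ^ N = ι at *
  clear ht hP1 hM1 hW hY
  subst hPx hPu hMx hMd
  have hγ : ι * γ ≠ 0 := mul_ne_zero hI hgc
  -- The Wronskian at `x - iℏ`, with its prefactors shifted back to `x`. Together with the Wronskian
  -- at `x` it removes `P₂` and `M₁` from the definition of `t_δ`, giving `hB`.
  have hA : ι * a * (P₂ * (m * d) - p * u * (m₂ * d₂)) = t₀ * p * m := by
    linear_combination (ι * a) * hWm - p₂ * ι * a * hsM - m * hsP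
  have hB : t * (p * u * (m * d)) * (ι * γ) =
      ι * γ * (t₀ * p * m) + ι * γ * (ι * a) * (p * u) * (m₂ * d₂) + p₁ * u₁ * (m * d) := by
    have ht₀ : t₀ * p * m ≠ 0 := mul_ne_zero (mul_ne_zero hx hp0) hm0
    apply mul_right_cancel₀ ht₀
    linear_combination (ι * a * P₂ * (m * d) - t * (p * u) * (m * d)) * hWx -
      (p * u) * (m * d) * htx + (ι * γ * t₀ * p * m + p₁ * u₁ * (m * d)) * hA
  have h2 : m₂ = m / (ι * γ * t₂) := by
    rw [eq_div_iff (mul_ne_zero hγ hdn), hsM]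
    ring
  have h1 : p₁ = ι * a * p / t₁ := by
    rw [eq_div_iff hup, ← hsP', mul_comm]
  rw [h1, h2, ← hρ] at hB
  apply mul_left_cancel₀ (mul_ne_zero (mul_ne_zero hp0 hm0) hγ)
  field_simp at hB ⊢
  linear_combination hB

end

/-! ### Asymptotic expansion of the Cauchy transform along the real axis -/

/-- Splits the exponent `1 = 1/4 + 3/4`: the quarter gives decay in `x` through `1 + |x| ≤ p q`, and
the rest is bounded by a sum of integrable powers. Any decay in `x` is enough for the little-o
remainder below. -/
theorem one_div_mul_le (x μ : ℝ) :
    1 / ((1 + |μ|) * (1 + |x - μ|)) ≤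
      (1 + |x|) ^ (-(1 / 4) : ℝ) *
        ((1 + |μ|) ^ (-(3 / 2) : ℝ) + (1 + |x - μ|) ^ (-(3 / 2) : ℝ)) := by
  set p := 1 + |μ| with hp
  set q := 1 + |x - μ| with hq
  have hp0 : 0 < p := by positivity
  have hq0 : 0 < q := by positivity
  have hpq : 1 + |x| ≤ p * q := by
    have : |x| ≤ |μ| + |x - μ| := by
      simpa using abs_add_le μ (x - μ)
    nlinarith [abs_nonneg μ, abs_nonneg (x - μ), mul_nonneg (abs_nonneg μ) (abs_nonneg (x - μ))]
  have e1 : 1 / (p * q) = (p * q) ^ (-(1 / 4) : ℝ) * (p ^ (-(3 / 4) : ℝ) * q ^ (-(3 / 4) : ℝ)) := by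
    rw [← Real.mul_rpow hp0.le hq0.le, ← Real.rpow_add (by positivity)]
    norm_num
    rw [Real.rpow_neg_one, mul_inv, mul_comm]
  have e2 : (p * q) ^ (-(1 / 4) : ℝ) ≤ (1 + |x|) ^ (-(1 / 4) : ℝ) :=
    Real.rpow_le_rpow_of_nonpos (by positivity) hpq (by norm_num)
  have sq : ∀ {t : ℝ}, 0 < t → t ^ (-(3 / 2) : ℝ) = t ^ (-(3 / 4) : ℝ) * t ^ (-(3 / 4) : ℝ) := by
    intro t ht
    rw [← Real.rpow_add ht]
    norm_num
  have e3 : p ^ (-(3 / 4) : ℝ) * q ^ (-(3 / 4) : ℝ) ≤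
      p ^ (-(3 / 2) : ℝ) + q ^ (-(3 / 2) : ℝ) := by
    rw [sq hp0, sq hq0]
    nlinarith [sq_nonneg (p ^ (-(3 / 4) : ℝ) - q ^ (-(3 / 4) : ℝ)),
      sq_nonneg (p ^ (-(3 / 4) : ℝ)), sq_nonneg (q ^ (-(3 / 4) : ℝ))]
  rw [e1]
  gcongr

theorem tendsto_one_add_abs_rpow :
    Tendsto (fun x : ℝ => (1 + |x|) ^ (-(1 / 4) : ℝ)) atTop (𝓝 0) := by
  have h1 : Tendsto (fun x : ℝ => 1 + |x|) atTop atTop :=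
    tendsto_atTop_add_const_left _ _ tendsto_abs_atTop_atTop
  exact (tendsto_rpow_neg_atTop (by norm_num : (0 : ℝ) < 1 / 4)).comp h1

theorem norm_ofReal_sub_pow_le (s : ℂ) (j : ℕ) (μ : ℝ) :
    ‖((μ : ℂ) - s) ^ j‖ ≤ (1 + ‖s‖) ^ j * (1 + |μ|) ^ j := by
  rw [norm_pow, ← mul_pow]
  gcongr
  have : ‖(μ : ℂ) - s‖ ≤ |μ| + ‖s‖ := by simpa using norm_sub_le (μ : ℂ) s
  nlinarith [norm_nonneg s, abs_nonneg μ, mul_nonneg (norm_nonneg s) (abs_nonneg μ)]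

theorem integrable_moment {f : ℝ → ℂ} {C : ℝ} {M : ℕ} (hf : Continuous f)
    (hb : ∀ μ, ‖f μ‖ ≤ C / (1 + |μ|) ^ (M + 1)) (s : ℂ) {j : ℕ} (hj : j < M) :
    Integrable fun μ : ℝ => ((μ : ℂ) - s) ^ j * f μ := by
  have hC : 0 ≤ C := by simpa using (norm_nonneg _).trans (hb 0)
  refine ((integrable_one_div_one_add_abs_pow (n := 2) le_rfl).const_mul
    ((1 + ‖s‖) ^ j * C)).mono' (by fun_prop) (Eventually.of_forall fun μ => ?_)
  rw [norm_mul]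
  have h1 : (1 : ℝ) ≤ 1 + |μ| := by linarith [abs_nonneg μ]
  calc ‖((μ : ℂ) - s) ^ j‖ * ‖f μ‖
      ≤ ((1 + ‖s‖) ^ j * (1 + |μ|) ^ j) * (C / (1 + |μ|) ^ (M + 1)) :=
        mul_le_mul (norm_ofReal_sub_pow_le s j μ) (hb μ) (norm_nonneg _) (by positivity)
    _ = (1 + ‖s‖) ^ j * C * ((1 + |μ|) ^ j / (1 + |μ|) ^ (M + 1)) := by ring
    _ ≤ (1 + ‖s‖) ^ j * C * (1 / (1 + |μ|) ^ 2) := by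
        refine mul_le_mul_of_nonneg_left ?_ (by positivity)
        rw [div_le_div_iff₀ (by positivity) (by positivity), ← pow_add, one_mul]
        exact pow_le_pow_right₀ h1 (by lia)

theorem one_div_sub_eq_geom {x u : ℂ} (hx : x ≠ 0) (hu : x - u ≠ 0) (M : ℕ) :
    1 / (x - u) - ∑ j ∈ Finset.range M, x⁻¹ ^ (j + 1) * u ^ j = x⁻¹ ^ M * (u ^ M / (x - u)) := by
  induction M with
  | zero => simp
  | succ M ih =>
    rw [Finset.sum_range_succ, ← sub_sub, ih, pow_succ x⁻¹]
    generalize x⁻¹ ^ M = y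
    field_simp
    ring

/-- Expands `1 / (x - (μ - s))` as a finite geometric sum. The remainder carries `(μ - s)^M f(μ)`,
only of order `1 / |μ|` and perhaps not integrable, so the decay of `1 / (x - (μ - s))` must be used
as well. -/
theorem cauchyTransform_expansion {f : ℝ → ℂ} {C : ℝ} {M : ℕ} (hM : 1 ≤ M) (hf : Continuous f)
    (hb : ∀ μ, ‖f μ‖ ≤ C / (1 + |μ|) ^ (M + 1)) {s : ℂ} (hs : s.im ≠ 0) :
    (fun x : ℝ => cauchyTransform f (x + s) - ∑ j ∈ Finset.range M,
      (x : ℂ)⁻¹ ^ (j + 1) * ∫ μ : ℝ, 1 / (2 * Real.pi * I) * (((μ : ℂ) - s) ^ j * f μ))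
      =o[atTop] fun x : ℝ => x⁻¹ ^ M := by
  have hC : 0 ≤ C := by simpa using (norm_nonneg _).trans (hb 0)
  have hfi : Integrable f := by simpa using integrable_moment hf hb 0 (j := 0) (by lia)
  obtain ⟨c, hc, hcμ⟩ := exists_le_norm_ofReal_sub (u := -s) (by simpa using hs)
  let J := ∫ μ : ℝ, (1 + |μ|) ^ (-(3 / 2) : ℝ)
  have hJ : Integrable fun μ : ℝ => (1 + |μ|) ^ (-(3 / 2) : ℝ) :=
    integrable_one_add_abs_rpow (by norm_num)
  let K := 1 / (2 * Real.pi) * ((1 + ‖s‖) ^ M * C / c)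
  have hbound : ∀ x : ℝ, 0 < x → ‖cauchyTransform f (x + s) - ∑ j ∈ Finset.range M,
      (x : ℂ)⁻¹ ^ (j + 1) * ∫ μ : ℝ, 1 / (2 * Real.pi * I) * (((μ : ℂ) - s) ^ j * f μ)‖ ≤
      (K * ((1 + |x|) ^ (-(1 / 4) : ℝ) * (J + J))) * ‖x⁻¹ ^ M‖ := by
    intro x hx
    have hxc : (x : ℂ) ≠ 0 := ofReal_ne_zero.2 hx.ne'
    have him : ((x : ℂ) + s).im ≠ 0 := by simpa using hs
    have hint : ∀ j ∈ Finset.range M, Integrable fun μ : ℝ =>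
        (x : ℂ)⁻¹ ^ (j + 1) * (1 / (2 * Real.pi * I) * (((μ : ℂ) - s) ^ j * f μ)) := fun j hj =>
      ((integrable_moment hf hb s (Finset.mem_range.1 hj)).const_mul _).const_mul _
    have hJx : Integrable fun μ : ℝ => (1 + |x - μ|) ^ (-(3 / 2) : ℝ) := hJ.comp_sub_left x
    have hJx' : ∫ μ : ℝ, (1 + |x - μ|) ^ (-(3 / 2) : ℝ) = J :=
      integral_sub_left_eq_self (fun μ : ℝ => (1 + |μ|) ^ (-(3 / 2) : ℝ)) volume x
    simp_rw [← integral_const_mul ((x : ℂ)⁻¹ ^ _)]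
    rw [cauchyTransform, ← integral_finsetSum _ hint, ← integral_sub (integrable_cauchy hfi him)
      (integrable_finsetSum _ hint), mul_comm _ ‖_‖, show J + J = J + ∫ μ : ℝ, (1 + |x - μ|) ^ (-(3 / 2) : ℝ) by rw [hJx'],
      ← integral_add hJ hJx,
      ← integral_const_mul, ← integral_const_mul, ← integral_const_mul]
    refine norm_integral_le_of_norm_le
      ((((hJ.add hJx).const_mul _).const_mul _).const_mul _) (Eventually.of_forall fun μ => ?_)
    have hne : (x : ℂ) - (μ - s) ≠ 0 := by
      intro h
      apply him
      have := congrArg im h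
      simp only [sub_im, ofReal_im, zero_im] at this
      simp only [add_im, ofReal_im]
      linarith
    have e : 1 / (2 * Real.pi * I) * (1 / ((x : ℂ) + s - μ)) * f μ - ∑ j ∈ Finset.range M,
        (x : ℂ)⁻¹ ^ (j + 1) * (1 / (2 * Real.pi * I) * (((μ : ℂ) - s) ^ j * f μ)) =
        (x : ℂ)⁻¹ ^ M * (1 / (2 * Real.pi * I) *
          (((μ : ℂ) - s) ^ M * f μ / ((x : ℂ) - (μ - s)))) := by
      have h1 := one_div_sub_eq_geom hxc hne M
      have h2 : ∑ j ∈ Finset.range M,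
          (x : ℂ)⁻¹ ^ (j + 1) * (1 / (2 * Real.pi * I) * (((μ : ℂ) - s) ^ j * f μ)) =
          (1 / (2 * Real.pi * I) * f μ) *
            ∑ j ∈ Finset.range M, (x : ℂ)⁻¹ ^ (j + 1) * ((μ : ℂ) - s) ^ j := by
        rw [Finset.mul_sum]
        exact Finset.sum_congr rfl fun j _ => by ring
      rw [h2, show (x : ℂ) + s - μ = x - (μ - s) by ring]
      linear_combination (1 / (2 * Real.pi * I) * f μ) * h1
    rw [e, norm_mul, norm_mul, norm_one_div_two_pi_I, norm_div, norm_mul]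
    have hx1 : ‖(x : ℂ)⁻¹ ^ M‖ = ‖x⁻¹ ^ M‖ := by
      rw [← ofReal_inv, ← ofReal_pow, norm_real]
    rw [hx1]
    simp only [K]
    rw [mul_assoc (1 / (2 * Real.pi))]
    gcongr
    have hden : c * (1 + |x - μ|) ≤ ‖(x : ℂ) - (μ - s)‖ := by
      have := hcμ (x - μ)
      rwa [show ((x - μ : ℝ) : ℂ) - -s = x - (μ - s) by push_cast; ring] at this
    calc ‖((μ : ℂ) - s) ^ M‖ * ‖f μ‖ / ‖(x : ℂ) - (μ - s)‖
        ≤ ((1 + ‖s‖) ^ M * (1 + |μ|) ^ M) * (C / (1 + |μ|) ^ (M + 1)) / (c * (1 + |x - μ|)) := by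
          gcongr
          · exact norm_ofReal_sub_pow_le s M μ
          · exact hb μ
      _ = (1 + ‖s‖) ^ M * C / c * (1 / ((1 + |μ|) * (1 + |x - μ|))) := by
          have h1 : 1 + |μ| ≠ 0 := by positivity
          have h2 : 1 + |x - μ| ≠ 0 := by positivity
          field_simp
          ring
      _ ≤ _ := by
          gcongr
          exact one_div_mul_le x μ
  rw [isLittleO_iff]
  intro ε hε
  have hlim : Tendsto (fun x : ℝ => K * ((1 + |x|) ^ (-(1 / 4) : ℝ) * (J + J))) atTop (𝓝 0) := by
    simpa using (tendsto_one_add_abs_rpow.mul_const (J + J)).const_mul K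
  filter_upwards [eventually_gt_atTop 0, hlim.eventually (gt_mem_nhds hε)] with x hx hxε
  exact (hbound x hx).trans (by gcongr)

/-! ### Asymptotics of monic polynomials -/

theorem tendsto_ofReal_inv_atTop : Tendsto (fun x : ℝ => (x : ℂ)⁻¹) atTop (𝓝 0) := by
  have := (continuous_ofReal.tendsto 0).comp tendsto_inv_atTop_zero
  simpa [Function.comp_def] using this

theorem tendsto_monic_div_pow {N : ℕ} (r : Fin N → ℂ) (s : ℂ) :
    Tendsto (fun x : ℝ => monic r (x + s) / (x : ℂ) ^ N) atTop (𝓝 1) := by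
  have h : Tendsto (fun x : ℝ => ∏ k, (1 + (s - r k) * (x : ℂ)⁻¹)) atTop (𝓝 1) := by
    have := tendsto_finsetProd (Finset.univ : Finset (Fin N)) fun k _ =>
      (tendsto_ofReal_inv_atTop.const_mul (s - r k)).const_add 1
    simpa using this
  refine h.congr' ?_
  filter_upwards [eventually_gt_atTop 0] with x hx
  have hxc : (x : ℂ) ≠ 0 := ofReal_ne_zero.2 hx.ne'
  have : (x : ℂ) ^ N = ∏ _k : Fin N, (x : ℂ) := by simp
  rw [this, monic, ← Finset.prod_div_distrib]
  refine Finset.prod_congr rfl fun k _ => ?_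
  field_simp
  ring

theorem inv_monic_isBigO {N : ℕ} (r : Fin N → ℂ) (s : ℂ) :
    (fun x : ℝ => (monic r (x + s))⁻¹) =O[atTop] fun x : ℝ => x⁻¹ ^ N := by
  have h1 : (fun x : ℝ => (monic r (x + s) / (x : ℂ) ^ N)⁻¹) =O[atTop] fun _ => (1 : ℝ) :=
    ((tendsto_monic_div_pow r s).inv₀ one_ne_zero).isBigO_one ℝ
  have h2 : (fun x : ℝ => (x : ℂ)⁻¹ ^ N) =O[atTop] fun x : ℝ => x⁻¹ ^ N :=
    isBigO_of_le _ fun x => by rw [← ofReal_inv, ← ofReal_pow, norm_real]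
  refine (h1.mul h2).congr' ?_ (by simp)
  filter_upwards [eventually_gt_atTop 0] with x hx
  have hxc : (x : ℂ) ^ N ≠ 0 := pow_ne_zero _ (ofReal_ne_zero.2 hx.ne')
  rw [inv_div, inv_pow]
  field_simp

theorem log_one_sub_expansion (r : ℂ) (M : ℕ) :
    (fun x : ℝ => log (1 - r * (x : ℂ)⁻¹) +
      ∑ j ∈ Finset.range M, (x : ℂ)⁻¹ ^ (j + 1) * (r ^ (j + 1) / (j + 1)))
      =o[atTop] fun x : ℝ => x⁻¹ ^ M := by
  have hz : Tendsto (fun x : ℝ => -(r * (x : ℂ)⁻¹)) atTop (𝓝 0) := by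
    simpa using (tendsto_ofReal_inv_atTop.const_mul r).neg
  have hlittle : (fun x : ℝ => x⁻¹ ^ (M + 1)) =o[atTop] fun x : ℝ => x⁻¹ ^ M := by
    simp_rw [pow_succ]
    have : (fun x : ℝ => x⁻¹) =o[atTop] fun _ => (1 : ℝ) :=
      (isLittleO_one_iff ℝ).2 tendsto_inv_atTop_zero
    simpa using (isBigO_refl (fun x : ℝ => x⁻¹ ^ M) atTop).mul_isLittleO this
  refine IsBigO.trans_isLittleO ?_ hlittle
  refine IsBigO.of_bound (2 * ‖r‖ ^ (M + 1)) ?_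
  have hsmall : ∀ᶠ x : ℝ in atTop, ‖-(r * (x : ℂ)⁻¹)‖ < 1 / 2 :=
    hz.norm.eventually (gt_mem_nhds (by norm_num))
  filter_upwards [hsmall] with x hx
  have h := norm_log_sub_logTaylor_le M (hx.trans (by norm_num))
  have e : log (1 - r * (x : ℂ)⁻¹) +
      ∑ j ∈ Finset.range M, (x : ℂ)⁻¹ ^ (j + 1) * (r ^ (j + 1) / (j + 1)) =
      log (1 + -(r * (x : ℂ)⁻¹)) - logTaylor (M + 1) (-(r * (x : ℂ)⁻¹)) := by
    -- The index `0` term of `logTaylor` is a division by zero, hence `0`; the sum starts at degree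
    -- one.
    rw [logTaylor, Finset.sum_range_succ', ← sub_eq_add_neg]
    simp only [pow_zero, Nat.cast_zero, div_zero, add_zero, sub_eq_add_neg, ← Finset.sum_neg_distrib]
    congr 1
    refine Finset.sum_congr rfl fun j _ => ?_
    rw [neg_pow (r * _), mul_pow r, pow_succ (-1 : ℂ) (j + 1)]
    have : (-1 : ℂ) ^ (j + 1) * (-1) ^ (j + 1) = 1 := by
      rw [← mul_pow]
      simp
    push_cast
    linear_combination (-(r ^ (j + 1) * (x : ℂ)⁻¹ ^ (j + 1) / (j + 1))) * this
  rw [e]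
  refine h.trans ?_
  have h1 : (1 - ‖-(r * (x : ℂ)⁻¹)‖)⁻¹ ≤ 2 := by
    rw [inv_le_comm₀ (by linarith) (by norm_num)]
    linarith
  have h2 : ‖-(r * (x : ℂ)⁻¹)‖ ^ (M + 1) = ‖r‖ ^ (M + 1) * ‖x⁻¹ ^ (M + 1)‖ := by
    rw [norm_neg, norm_mul, mul_pow, norm_inv, norm_real, norm_pow, norm_inv]
  rw [h2]
  calc ‖r‖ ^ (M + 1) * ‖x⁻¹ ^ (M + 1)‖ * (1 - ‖-(r * (x : ℂ)⁻¹)‖)⁻¹ / (M + 1)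
      ≤ ‖r‖ ^ (M + 1) * ‖x⁻¹ ^ (M + 1)‖ * (1 - ‖-(r * (x : ℂ)⁻¹)‖)⁻¹ :=
        div_le_self (by have : 0 < 1 - ‖-(r * (x : ℂ)⁻¹)‖ := by linarith
                        positivity) (by linarith [(Nat.cast_nonneg M : (0 : ℝ) ≤ M)])
    _ ≤ ‖r‖ ^ (M + 1) * ‖x⁻¹ ^ (M + 1)‖ * 2 := by gcongr
    _ = _ := by ring

/-- Multiplying by `x` and letting `x → ∞` isolates the leading coefficient; induction handles the
rest. -/
theorem coeff_eq_zero_of_isLittleO {M : ℕ} {c : ℕ → ℂ}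
    (h : (fun x : ℝ => ∑ j ∈ Finset.range M, (x : ℂ)⁻¹ ^ (j + 1) * c j)
      =o[atTop] fun x : ℝ => x⁻¹ ^ M) : ∀ j < M, c j = 0 := by
  induction M generalizing c with
  | zero => simp
  | succ M ih =>
    have hinv : (fun x : ℝ => (x : ℂ)) =O[atTop] fun x : ℝ => x :=
      isBigO_of_le _ fun x => by simp
    have h1 : (fun x : ℝ => ∑ j ∈ Finset.range (M + 1), (x : ℂ)⁻¹ ^ j * c j)
        =o[atTop] fun x : ℝ => x⁻¹ ^ M := by
      refine (hinv.mul_isLittleO h).congr' ?_ ?_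
      · filter_upwards [eventually_gt_atTop 0] with x hx
        have hxc : (x : ℂ) ≠ 0 := ofReal_ne_zero.2 hx.ne'
        rw [Finset.mul_sum]
        refine Finset.sum_congr rfl fun j _ => ?_
        rw [pow_succ]
        field_simp
      · filter_upwards [eventually_gt_atTop 0] with x hx
        rw [pow_succ]
        field_simp
    have hlim0 : Tendsto (fun x : ℝ => ∑ j ∈ Finset.range (M + 1), (x : ℂ)⁻¹ ^ j * c j)
        atTop (𝓝 0) := by
      have : (fun x : ℝ => x⁻¹ ^ M) =O[atTop] fun _ => (1 : ℝ) :=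
        (tendsto_inv_atTop_zero.pow M).isBigO_one ℝ
      exact (isLittleO_one_iff ℝ).1 (h1.trans_isBigO this)
    have hlimc : Tendsto (fun x : ℝ => ∑ j ∈ Finset.range (M + 1), (x : ℂ)⁻¹ ^ j * c j)
        atTop (𝓝 (c 0)) := by
      have := tendsto_finsetSum (Finset.range (M + 1)) fun j _ =>
        (tendsto_ofReal_inv_atTop.pow j).mul_const (c j)
      rw [Finset.sum_range_succ'] at this
      simpa using this
    have hc0 : c 0 = 0 := tendsto_nhds_unique hlimc hlim0
    have h2 := ih (c := fun j => c (j + 1)) (h1.congr_left fun x => by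
      rw [Finset.sum_range_succ', hc0]
      simp)
    intro j hj
    cases j with
    | zero => exact hc0
    | succ j => exact h2 j (by lia)

/-- Takes the logarithm of the asymptotic relation without a choice of branch: an exponent already
known to tend to `0` is controlled by `exp E - 1`. -/
theorem isBigO_exp_sub_one_of_tendsto_zero {α : Type*} {l : Filter α} {E : α → ℂ}
    (hE : Tendsto E l (𝓝 0)) : E =O[l] fun x => exp (E x) - 1 := by
  refine IsBigO.of_bound 2 ?_
  have hsmall : ∀ᶠ x in l, ‖E x‖ < 1 / 2 := by
    have := hE.norm
    rw [norm_zero] at this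
    exact this.eventually (gt_mem_nhds (by norm_num))
  filter_upwards [hsmall] with x hx
  have h1 := norm_exp_sub_one_sub_id_le (x := E x) (by linarith)
  have h2 : ‖E x‖ ≤ ‖exp (E x) - 1‖ + ‖exp (E x) - 1 - E x‖ := by
    have := norm_sub_le (exp (E x) - 1) (exp (E x) - 1 - E x)
    rwa [sub_sub_cancel] at this
  nlinarith [norm_nonneg (E x)]

theorem tendsto_sum_inv_pow (M : ℕ) (c : ℕ → ℂ) :
    Tendsto (fun x : ℝ => ∑ j ∈ Finset.range M, (x : ℂ)⁻¹ ^ (j + 1) * c j) atTop (𝓝 0) := by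
  have := tendsto_finsetSum (Finset.range M) fun j _ =>
    (tendsto_ofReal_inv_atTop.pow (j + 1)).mul_const (c j)
  simpa using this

theorem sum_log_one_sub_expansion {N : ℕ} (r : Fin N → ℂ) (M : ℕ) :
    (fun x : ℝ => ∑ k, log (1 - r k * (x : ℂ)⁻¹) +
      ∑ j ∈ Finset.range M, (x : ℂ)⁻¹ ^ (j + 1) * ((∑ k, r k ^ (j + 1)) / (j + 1)))
      =o[atTop] fun x : ℝ => x⁻¹ ^ M := by
  refine (IsLittleO.fun_sum (s := Finset.univ) fun k _ => log_one_sub_expansion (r k) M).congr_left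
    fun x => ?_
  rw [Finset.sum_add_distrib, Finset.sum_comm]
  simp only [Finset.sum_div, Finset.mul_sum]

theorem eventually_exp_sum_log {N : ℕ} (r : Fin N → ℂ) :
    ∀ᶠ x : ℝ in atTop, monic r x ≠ 0 ∧
      exp (∑ k, log (1 - r k * (x : ℂ)⁻¹)) = monic r x / (x : ℂ) ^ N := by
  have h : ∀ k, ∀ᶠ x : ℝ in atTop, 1 - r k * (x : ℂ)⁻¹ ≠ 0 := by
    intro k
    have : Tendsto (fun x : ℝ => 1 - r k * (x : ℂ)⁻¹) atTop (𝓝 1) := by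
      simpa using (tendsto_ofReal_inv_atTop.const_mul (r k)).const_sub 1
    exact this.eventually_ne one_ne_zero
  filter_upwards [eventually_all.2 h, eventually_gt_atTop 0] with x hx hx0
  have hxc : (x : ℂ) ≠ 0 := ofReal_ne_zero.2 hx0.ne'
  have e : monic r x = (x : ℂ) ^ N * ∏ k, (1 - r k * (x : ℂ)⁻¹) := by
    have : (x : ℂ) ^ N = ∏ _k : Fin N, (x : ℂ) := by simp
    rw [this, ← Finset.prod_mul_distrib, monic]
    refine Finset.prod_congr rfl fun k _ => ?_
    field_simp
  have e2 : exp (∑ k, log (1 - r k * (x : ℂ)⁻¹)) = ∏ k, (1 - r k * (x : ℂ)⁻¹) := by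
    rw [exp_sum]
    exact Finset.prod_congr rfl fun k _ => exp_log (hx k)
  refine ⟨?_, ?_⟩
  · rw [e]
    exact mul_ne_zero (pow_ne_zero _ hxc) (Finset.prod_ne_zero_iff.2 fun k _ => hx k)
  · rw [e2, e]
    field_simp

/-! ### Comparison of the asymptotic expansions and the power sums -/

section

variable {hbar g κ : ℝ} {N : ℕ} {δ τ : Fin N → ℂ} {Y : ℝ → ℝ}

theorem isBigO_one_exp_cauchyLogV {ρ : ℝ} (hN : N ≠ 0) (hρ : 0 < ρ)
    (him : ∀ k, |(δ k).im| < hbar / 2) (hY : IsNLIESolution hbar ρ δ Y) {s : ℂ} (hs : s.im ≠ 0) :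
    (fun x : ℝ => exp (cauchyLogV hbar ρ δ Y (x + s))) =O[atTop] (fun _ => (1 : ℝ)) ∧
      (fun x : ℝ => exp (-cauchyLogV hbar ρ δ Y (x + s))) =O[atTop] (fun _ => (1 : ℝ)) := by
  have hb : ∀ x : ℝ, ‖cauchyLogV hbar ρ δ Y (x + s)‖ ≤
      1 / (2 * Real.pi) * (1 / |s.im|) * ∫ μ, ‖logV hbar ρ δ Y μ‖ := fun x =>
    norm_cauchyTransform_le (integrable_logV hN hρ him hY) (abs_pos.2 hs) (by simp)
  set K := 1 / (2 * Real.pi) * (1 / |s.im|) * ∫ μ, ‖logV hbar ρ δ Y μ‖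
  constructor
  · refine IsBigO.of_bound (Real.exp K) (Eventually.of_forall fun x => ?_)
    rw [norm_one, mul_one, norm_exp]
    exact Real.exp_le_exp.2 ((re_le_norm _).trans (hb x))
  · refine IsBigO.of_bound (Real.exp K) (Eventually.of_forall fun x => ?_)
    rw [norm_one, mul_one, norm_exp]
    exact Real.exp_le_exp.2 ((re_le_norm _).trans (by rw [norm_neg]; exact hb x))

/-- On the real axis, `t v_↑ v_↓ / ϑ` is `1` up to terms of order `x ^ (-2 N)`. -/
theorem monic_ratio_isBigO (hh : 0 < hbar) (hg : 0 < g) (hκ : 0 < κ) (hN : N ≠ 0)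
    (hδ : SelfConj δ) (him : ∀ k, |(δ k).im| < hbar / 2)
    (hY : IsNLIESolution hbar (κ * g ^ (2 * N)) δ Y) (ht : IsZerosOfTDelta hbar g κ δ τ Y) :
    (fun x : ℝ => monic τ x * (vUp hbar (κ * g ^ (2 * N)) δ Y x *
      vDownShift hbar (κ * g ^ (2 * N)) δ Y x) / monic δ x - 1)
      =O[atTop] fun x : ℝ => x⁻¹ ^ (2 * N) := by
  set ρ := κ * g ^ (2 * N) with hρdef
  have hρ : 0 < ρ := by positivity
  have hT := fun {s : ℂ} => isBigO_one_exp_cauchyLogV (s := s) hN hρ him hY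
  have hu : (fun x : ℝ => vUp hbar ρ δ Y x) =O[atTop] fun _ => (1 : ℝ) := by
    simp only [vUp_eq]
    exact (hT (by simp [hh.ne'])).2
  have hu₁ : (fun x : ℝ => vUp hbar ρ δ Y (x + I * hbar)) =O[atTop] fun _ => (1 : ℝ) := by
    simp only [vUp_eq, add_assoc]
    exact (hT (by simp; linarith)).2
  have hd : (fun x : ℝ => vDownShift hbar ρ δ Y x) =O[atTop] fun _ => (1 : ℝ) := by
    simp only [vDownShift_eq, sub_eq_add_neg]
    exact (hT (by simp [hh.ne'])).1
  have hd₂ : (fun x : ℝ => vDownShift hbar ρ δ Y (x - I * hbar)) =O[atTop] fun _ => (1 : ℝ) := by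
    simp only [vDownShift_eq, sub_eq_add_neg, add_assoc]
    exact (hT (by simp; linarith)).1
  have h₀ : (fun x : ℝ => (monic δ x)⁻¹) =O[atTop] fun x : ℝ => x⁻¹ ^ N := by
    simpa using inv_monic_isBigO δ 0
  have h₁ := inv_monic_isBigO δ (I * hbar)
  have h₂ : (fun x : ℝ => (monic δ (x - I * hbar))⁻¹) =O[atTop] fun x : ℝ => x⁻¹ ^ N := by
    simpa only [sub_eq_add_neg] using inv_monic_isBigO δ (-(I * hbar))
  have key := ((((hu₁.mul hd).mul h₁).add ((hu.mul hd₂).mul h₂)).mul h₀).const_mul_left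
    ((ρ ^ hbar : ℝ) : ℂ)
  refine key.congr' ?_ (Eventually.of_forall fun x => by ring)
  filter_upwards [eventually_exp_sum_log δ] with x hx
  rw [monic_mul_vUp_mul_vDownShift hh hg hκ hN hδ him hY ht hx.1, add_div, div_self hx.1]
  ring

theorem sum_pow_eq (hh : 0 < hbar) (hg : 0 < g) (hκ : 0 < κ) (hN : N ≠ 0)
    (hδ : SelfConj δ) (him : ∀ k, |(δ k).im| < hbar / 2)
    (hY : IsNLIESolution hbar (κ * g ^ (2 * N)) δ Y) (ht : IsZerosOfTDelta hbar g κ δ τ Y)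
    {j : ℕ} (hj : j < 2 * N - 1) :
    (∑ p, τ p ^ (j + 1)) / (j + 1) = (∑ p, δ p ^ (j + 1)) / (j + 1) +
      ((∫ μ : ℝ, 1 / (2 * Real.pi * I) *
          (((μ : ℂ) - -(I * hbar / 2)) ^ j * logV hbar (κ * g ^ (2 * N)) δ Y μ)) -
        ∫ μ : ℝ, 1 / (2 * Real.pi * I) *
          (((μ : ℂ) - I * hbar / 2) ^ j * logV hbar (κ * g ^ (2 * N)) δ Y μ)) := by
  have hratio := monic_ratio_isBigO hh hg hκ hN hδ him hY ht
  set ρ := κ * g ^ (2 * N) with hρdef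
  have hρ : 0 < ρ := by positivity
  -- With `M = 2N - 1` the expansions hold up to `o(x^(-M))`, while the ratio is `1 + O(x^(-(M +
  -- 1)))`; so all coefficients of `x^(-1), …, x^(-M)` must vanish.
  obtain ⟨M, hM⟩ : ∃ M, 2 * N = M + 1 := ⟨2 * N - 1, by lia⟩
  obtain ⟨C, -, hC⟩ := exists_norm_logV_le hρ him hY
  rw [hM] at hC hratio hj
  have hM1 : 1 ≤ M := by lia
  have hc := continuous_logV hρ him hY
  have hup := cauchyTransform_expansion (s := I * hbar / 2) hM1 hc hC (by simp [hh.ne'])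
  have hdn := cauchyTransform_expansion (s := -(I * hbar / 2)) hM1 hc hC (by simp [hh.ne'])
  let mom : ℂ → ℕ → ℂ := fun s j =>
    ∫ μ : ℝ, 1 / (2 * Real.pi * I) * (((μ : ℂ) - s) ^ j * logV hbar ρ δ Y μ)
  let c : ℕ → ℂ := fun j => (∑ k, δ k ^ (j + 1)) / (j + 1) - (∑ k, τ k ^ (j + 1)) / (j + 1) -
    mom (I * hbar / 2) j + mom (-(I * hbar / 2)) j
  -- An explicit logarithm of `t v_↑ v_↓ / ϑ`; the powers `x^N` from the two polynomials cancel.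
  let E : ℝ → ℂ := fun x => ∑ k, log (1 - τ k * (x : ℂ)⁻¹) - ∑ k, log (1 - δ k * (x : ℂ)⁻¹) -
    cauchyLogV hbar ρ δ Y (x + I * hbar / 2) + cauchyLogV hbar ρ δ Y (x + -(I * hbar / 2))
  have hexpand : (fun x : ℝ => E x - ∑ j ∈ Finset.range M, (x : ℂ)⁻¹ ^ (j + 1) * c j)
      =o[atTop] fun x : ℝ => x⁻¹ ^ M := by
    have := (((sum_log_one_sub_expansion τ M).sub (sum_log_one_sub_expansion δ M)).sub hup).add hdn
    refine this.congr_left fun x => ?_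
    simp only [E, c, mom, cauchyLogV, mul_add, mul_sub, Finset.sum_add_distrib,
      Finset.sum_sub_distrib]
    ring
  have hE0 : Tendsto E atTop (𝓝 0) := by
    have h1 : (fun x : ℝ => x⁻¹ ^ M) =O[atTop] fun _ => (1 : ℝ) :=
      (tendsto_inv_atTop_zero.pow M).isBigO_one ℝ
    have h2 := (isLittleO_one_iff ℝ).1 (hexpand.trans_isBigO h1)
    simpa using h2.add (tendsto_sum_inv_pow M c)
  have hEO : E =O[atTop] fun x : ℝ => x⁻¹ ^ (M + 1) := by
    refine (isBigO_exp_sub_one_of_tendsto_zero hE0).trans (hratio.congr' ?_ EventuallyEq.rfl)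
    filter_upwards [eventually_exp_sum_log τ, eventually_exp_sum_log δ, eventually_gt_atTop 0]
      with x hxτ hxδ hx0
    have hxc : (x : ℂ) ^ N ≠ 0 := pow_ne_zero _ (ofReal_ne_zero.2 hx0.ne')
    have hδ0 := hxδ.1
    simp only [E]
    rw [exp_add, exp_sub, exp_sub, hxτ.2, hxδ.2, vUp_eq, vDownShift_eq, exp_neg,
      ← sub_eq_add_neg]
    field_simp
  have hlittle : (fun x : ℝ => x⁻¹ ^ (M + 1)) =o[atTop] fun x : ℝ => x⁻¹ ^ M := by
    simp_rw [pow_succ]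
    have : (fun x : ℝ => x⁻¹) =o[atTop] fun _ => (1 : ℝ) :=
      (isLittleO_one_iff ℝ).2 tendsto_inv_atTop_zero
    simpa using (isBigO_refl (fun x : ℝ => x⁻¹ ^ M) atTop).mul_isLittleO this
  have hpoly : (fun x : ℝ => ∑ j ∈ Finset.range M, (x : ℂ)⁻¹ ^ (j + 1) * c j)
      =o[atTop] fun x : ℝ => x⁻¹ ^ M :=
    ((hEO.trans_isLittleO hlittle).sub hexpand).congr_left fun x => by ring
  have hcj : c j = 0 := coeff_eq_zero_of_isLittleO hpoly j (by lia)
  simp only [c, mom] at hcj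
  linear_combination -hcj

theorem integrable_moment_logV {ρ : ℝ} (hρ : 0 < ρ) (him : ∀ k, |(δ k).im| < hbar / 2)
    (hY : IsNLIESolution hbar ρ δ Y) (s : ℂ) {j : ℕ} (hj : j < 2 * N - 1) :
    Integrable fun μ : ℝ => ((μ : ℂ) - s) ^ j * logV hbar ρ δ Y μ := by
  obtain ⟨C, -, hC⟩ := exists_norm_logV_le hρ him hY
  rw [show 2 * N = 2 * N - 1 + 1 by lia] at hC
  exact integrable_moment (continuous_logV hρ him hY) hC s hj

end

end TodaTBA

end

theorem mainTheorem4 (N : ℕ) (hbar g κ : ℝ) (hhbar : 0 < hbar) (hg : 0 < g) (hκ : 0 < κ)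
    (τ δ : Fin N → ℂ) (Y : ℝ → ℝ)
    (hδ : TodaTBA.SelfConj δ)
    (hHill : TodaTBA.IsHillZeros hbar (κ * g ^ (2 * N)) τ δ)
    (hY : TodaTBA.IsNLIESolution hbar (κ * g ^ (2 * N)) δ Y)
    (ht : TodaTBA.IsZerosOfTDelta hbar g κ δ τ Y)
    (hτ : ∀ a, |(τ a).im| < hbar / 2)
    (k : ℕ) (hk : 1 ≤ k) (hkN : k ≤ 2 * N - 1) :
    MeasureTheory.Integrable (fun μ : ℝ =>
        (((μ : ℂ) + Complex.I * hbar / 2) ^ (k - 1) - ((μ : ℂ) - Complex.I * hbar / 2) ^ (k - 1)) *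
          (Real.log (TodaTBA.V hbar (κ * g ^ (2 * N)) δ Y μ) : ℂ)) ∧
      ∑ p, τ p ^ k = ∑ p, δ p ^ k +
        k * ∫ μ : ℝ, 1 / (2 * Real.pi * Complex.I) *
          ((((μ : ℂ) + Complex.I * hbar / 2) ^ (k - 1) -
              ((μ : ℂ) - Complex.I * hbar / 2) ^ (k - 1)) *
            (Real.log (TodaTBA.V hbar (κ * g ^ (2 * N)) δ Y μ) : ℂ)) := by
  have hN : N ≠ 0 := by lia
  have hρ : 0 < κ * g ^ (2 * N) := by positivity
  obtain ⟨j, rfl⟩ : ∃ j, k = j + 1 := ⟨k - 1, by lia⟩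
  have hj : j < 2 * N - 1 := by lia
  have h1 := TodaTBA.integrable_moment_logV hρ hHill.1 hY (-(I * hbar / 2)) hj
  have h2 := TodaTBA.integrable_moment_logV hρ hHill.1 hY (I * hbar / 2) hj
  have hsum := TodaTBA.sum_pow_eq hhbar hg hκ hN hδ hHill.1 hY ht hj
  rw [← integral_sub (h1.const_mul _) (h2.const_mul _)] at hsum
  simp only [← mul_sub, ← sub_mul, sub_neg_eq_add, TodaTBA.logV] at hsum
  refine ⟨?_, ?_⟩
  · refine (h1.sub h2).congr (Eventually.of_forall fun μ => ?_)
    simp only [Pi.sub_apply, ← sub_mul, sub_neg_eq_add, TodaTBA.logV, Nat.add_sub_cancel]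
  · have hj1 : ((j : ℂ) + 1) ≠ 0 := by exact_mod_cast j.succ_ne_zero
    rw [Nat.add_sub_cancel, Nat.cast_add, Nat.cast_one]
    rw [div_add' _ _ _ hj1, div_left_inj' hj1] at hsum
    rw [hsum]
    ring
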